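/- Let $k$ be a field and let $\mathcal C$ be a multi-fusion category over $k$, i.e. a rigid monoidal category which is $k$-linear with $k$-bilinear tensor product and which is $k$-linearly equivalent to the category of finite-dimensional right modules over some finite-dimensional semisimple $k$-algebra. Definitions. An algebra in $\mathcal C$ means a unital associative algebra object. An algebra $A$ in $\mathcal C$ is separable if its multiplication $A\otimes A\to A$ splits as a map of $A$-$A$-bimodules. It is a division algebra if it is simple as a right module over itself; it is simple if the category of right $A$-modules in $\mathcal C$ is semisimple (in the above sense: equivalent to finite-dimensional modules over a finite-dimensional semisimple $k$-algebra) and indecomposable as a left $\mathcal C$-module category (nonzero, and not a direct sum of two nonzero $\mathcal C$-module categories). An $A$-$B$-bimodule $P$ is invertible if there is a $B$-$A$-bimodule $Q$ with $P\otimes_B Q\simeq A$ and $Q\otimes_A P\simeq B$ as bimodules; $A$ and $B$ are Morita equivalent if such a $P$ exists. A matrix algebra is an algebra $A$ admitting a decomposition $A\simeq\bigoplus_{i,j=1}^n A_{ij}$ in $\mathcal C$ ($n\ge 1$) such that the $A_{ii}$ are simple division algebras, each $A_{ij}$ is an invertible $A_{ii}$-$A_{jj}$-bimodule (with $A_{ii}$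 the regular bimodule for $i=j$), and there are isomorphisms of $A_{ii}$-$A_{ll}$-bimodules $A_{ij}\otimes_{A_{jj}}A_{jl}\simeq A_{il}$ that induce the multiplication of $A$ (which vanishes on $A_{ij}\otimes A_{j'l}$ for $j\ne j'$). Theorem. (1) An algebra in $\mathcal C$ is separable if and only if it is isomorphic to a finite (possibly empty) direct sum of separable matrix algebras. (2) A matrix algebra $A\simeq\bigoplus_{i,j=1}^n A_{ij}$ in $\mathcal C$ is separable if and only if the division algebra $A_{11}$ is separable. (3) Separability is Morita invariant: if $A$ and $B$ are Morita equivalent algebras in $\mathcal C$, then $A$ is separable if and only if $B$ is separable. -/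

import Mathlib

open CategoryTheory CategoryTheory.Limits MonoidalCategory MonObj
open scoped MonoidalLeftAction

universe w v u v₁ u₁

noncomputable section

namespace MultiFusion

/-! ### Tensoring in a rigid category preserves colimits -/

instance preservesColimits_tensorLeft {C : Type u} [Category.{v} C] [MonoidalCategory C]
    [RigidCategory C] (X : C) : PreservesColimitsOfSize.{0, 0} (tensorLeft X) :=
  (tensorLeftAdjunction (ᘁX) X).leftAdjoint_preservesColimits

instance preservesColimits_tensorRight {C : Type u} [Category.{v} C] [MonoidalCategory C]
    [RigidCategory C] (X : C) : PreservesColimitsOfSize.{0, 0} (tensorRight X) :=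
  (tensorRightAdjunction X Xᘁ).leftAdjoint_preservesColimits

/-! ### Semisimple categories and module categories -/

/-- A `k`-linear category is (finite) semisimple if it is `k`-linearly equivalent to the category
of finite-dimensional right modules over some finite-dimensional semisimple `k`-algebra `R`.
Right `R`-modules are encoded as modules over `Rᵐᵒᵖ`. -/
def IsSemisimpleCategory (k : Type w) [Field k] (M : Type u₁) [Category.{v₁} M] [Preadditive M]
    [Linear k M] : Prop :=
  ∃ (R : Type w) (_ : Ring R) (_ : Algebra k R) (_ : Module.Finite k R) (_ : IsSemisimpleRing R)
    (e : M ≌ FGModuleCat.{w} Rᵐᵒᵖ), e.functor.Additive ∧ Functor.Linear k e.functor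

/-- The left `C`-module category `M` is the direct sum of its two full `C`-submodule categories
with objects `P` and `Q`. -/
structure IsModuleDirectSum (C : Type u) [Category.{v} C] [MonoidalCategory C]
    {M : Type u₁} [Category.{v₁} M] [Preadditive M] [MonoidalLeftAction C M]
    (P Q : ObjectProperty M) : Prop where
  iso_left : P.IsClosedUnderIsomorphisms
  iso_right : Q.IsClosedUnderIsomorphisms
  act_left : ∀ (c : C) (x : M), P x → P (c ⊙ₗ x)
  act_right : ∀ (c : C) (x : M), Q x → Q (c ⊙ₗ x)
  hom_left_right : ∀ (x y : M) (f : x ⟶ y), P x → Q y → f = 0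
  hom_right_left : ∀ (x y : M) (f : y ⟶ x), P x → Q y → f = 0
  exists_sum : ∀ z : M, ∃ (x y : M) (b : BinaryBicone x y),
    P x ∧ Q y ∧ Nonempty b.IsBilimit ∧ Nonempty (z ≅ b.pt)

/-- A left `C`-module category is indecomposable if it is nonzero and is not the direct sum of two
nonzero `C`-module categories. -/
def IsIndecomposableModule (C : Type u) [Category.{v} C] [MonoidalCategory C]
    (M : Type u₁) [Category.{v₁} M] [Preadditive M] [MonoidalLeftAction C M] : Prop :=
  (∃ x : M, ¬ IsZero x) ∧
    ∀ P Q : ObjectProperty M, IsModuleDirectSum C P Q →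
      (∀ x, P x → IsZero x) ∨ (∀ x, Q x → IsZero x)

/-! ### The category of right modules over an algebra, as a left module category -/

/-- A right module over the algebra `A` in `C`. -/
structure RMod {C : Type u} [Category.{v} C] [MonoidalCategory C] (A : Mon C) where
  X : C
  act : X ⊗ A.X ⟶ X
  act_one : X ◁ η ≫ act = (ρ_ X).hom
  act_assoc : X ◁ μ ≫ act = (α_ X A.X A.X).inv ≫ act ▷ A.X ≫ act

namespace RMod

section Basic

variable {C : Type u} [Category.{v} C] [MonoidalCategory C] {A : Mon C}

/-- A morphism of right modules. -/
@[ext]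
structure Hom (M N : RMod A) where
  hom : M.X ⟶ N.X
  act_hom : M.act ≫ hom = hom ▷ A.X ≫ N.act

instance : Category (RMod A) where
  Hom M N := Hom M N
  id M := ⟨𝟙 M.X, by simp⟩
  comp f g := ⟨f.hom ≫ g.hom, by
    rw [← Category.assoc, f.act_hom, Category.assoc, g.act_hom, comp_whiskerRight,
      Category.assoc]⟩

@[ext]
lemma hom_ext {M N : RMod A} (f g : M ⟶ N) (h : f.hom = g.hom) : f = g := Hom.ext h

@[simp] lemma id_hom (M : RMod A) : Hom.hom (𝟙 M) = 𝟙 M.X := rfl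

@[simp] lemma comp_hom {M N K : RMod A} (f : M ⟶ N) (g : N ⟶ K) :
    Hom.hom (f ≫ g) = f.hom ≫ g.hom := rfl

/-- An isomorphism of underlying objects that is a module map is an isomorphism of modules. -/
@[simps]
def isoMk {M N : RMod A} (e : M.X ≅ N.X) (h : M.act ≫ e.hom = e.hom ▷ A.X ≫ N.act) : M ≅ N where
  hom := ⟨e.hom, h⟩
  inv := ⟨e.inv, by
    rw [← cancel_mono e.hom, Category.assoc, Category.assoc, e.inv_hom_id, Category.comp_id, h,
      ← Category.assoc, ← comp_whiskerRight, e.inv_hom_id, id_whiskerRight, Category.id_comp]⟩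

variable (A) in
/-- The algebra `A` as a right module over itself. -/
@[simps]
def regular : RMod A where
  X := A.X
  act := μ
  act_one := by simp
  act_assoc := by simp

/-- The right module `c ⊗ M`, for `c` an object of `C`. -/
@[simps]
def tensorObj (c : C) (M : RMod A) : RMod A where
  X := c ⊗ M.X
  act := (α_ c M.X A.X).hom ≫ c ◁ M.act
  act_one := by
    rw [tensor_whiskerLeft]
    simp only [Category.assoc, Iso.inv_hom_id_assoc]
    rw [← whiskerLeft_comp, M.act_one]
    simp
  act_assoc := by
    rw [tensor_whiskerLeft]
    simp only [Category.assoc, Iso.inv_hom_id_assoc, comp_whiskerRight]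
    rw [← whiskerLeft_comp, M.act_assoc]
    simp

/-- The category of right `A`-modules in `C` is a left `C`-module category. -/
instance : MonoidalLeftAction C (RMod A) where
  actionObj c M := tensorObj c M
  actionHomLeft {c c'} f M := ⟨f ▷ M.X, by
    dsimp only [tensorObj]
    rw [Category.assoc, whisker_exchange, ← associator_naturality_left_assoc]⟩
  actionHomRight c {M N} f := ⟨c ◁ f.hom, by
    dsimp only [tensorObj]
    rw [Category.assoc, ← whiskerLeft_comp, f.act_hom, whiskerLeft_comp,
      associator_naturality_middle_assoc]⟩
  actionAssocIso c c' M := isoMk (α_ c c' M.X) (by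
    dsimp only [tensorObj]; simp)
  actionUnitIso M := isoMk (λ_ M.X) (by
    dsimp only [tensorObj]; simp)
  actionHom_comp f₁ f₂ g₁ g₂ := by
    ext
    dsimp [tensorObj]
    simp only [comp_whiskerRight, MonoidalCategory.whiskerLeft_comp, Category.assoc]
    rw [whisker_exchange_assoc]
  actionAssocIso_hom_naturality f g h := by
    ext
    dsimp [isoMk, tensorObj]
    simp [MonoidalCategory.tensorHom_def]
  actionUnitIso_hom_naturality f := by
    ext
    dsimp [isoMk, tensorObj]
    simp
  whiskerRight_actionHomLeft c'' f M := by
    ext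
    dsimp [isoMk, tensorObj]
    simp
  associator_actionHom c₁ c₂ c₃ M := by
    ext
    dsimp [isoMk, tensorObj]
    simp
  leftUnitor_actionHom c M := by
    ext
    dsimp [isoMk, tensorObj]
    simp
  rightUnitor_actionHom c M := by
    ext
    dsimp [isoMk, tensorObj]
    simp

end Basic

lemma hom_injective {C : Type u} [Category.{v} C] [MonoidalCategory C] {A : Mon C}
    (M N : RMod A) : Function.Injective (fun f : M ⟶ N => f.hom) := fun f g h => hom_ext f g h

section Linear

variable {C : Type u} [Category.{v} C] [MonoidalCategory C] [Preadditive C]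
  [MonoidalPreadditive C] {A : Mon C}

instance (M N : RMod A) : Zero (M ⟶ N) := ⟨⟨0, by simp⟩⟩
instance (M N : RMod A) : Add (M ⟶ N) :=
  ⟨fun f g => ⟨f.hom + g.hom, by simp [f.act_hom, g.act_hom]⟩⟩
instance (M N : RMod A) : Neg (M ⟶ N) :=
  ⟨fun f => ⟨-f.hom, by
    have h : (-f.hom) ▷ A.X = -(f.hom ▷ A.X) := (tensorRight A.X).map_neg
    simp [h, f.act_hom]⟩⟩
instance (M N : RMod A) : Sub (M ⟶ N) :=
  ⟨fun f g => ⟨f.hom - g.hom, by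
    have h : (f.hom - g.hom) ▷ A.X = f.hom ▷ A.X - g.hom ▷ A.X := (tensorRight A.X).map_sub
    simp [h, f.act_hom, g.act_hom]⟩⟩
instance (M N : RMod A) : SMul ℕ (M ⟶ N) :=
  ⟨fun n f => ⟨n • f.hom, by
    have h : (n • f.hom) ▷ A.X = n • (f.hom ▷ A.X) := (tensorRight A.X).map_nsmul
    simp [h, f.act_hom]⟩⟩
instance (M N : RMod A) : SMul ℤ (M ⟶ N) :=
  ⟨fun n f => ⟨n • f.hom, by
    have h : (n • f.hom) ▷ A.X = n • (f.hom ▷ A.X) := (tensorRight A.X).map_zsmul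
    simp [h, f.act_hom]⟩⟩

@[simp] lemma zero_hom (M N : RMod A) : Hom.hom (0 : M ⟶ N) = 0 := rfl
@[simp] lemma add_hom {M N : RMod A} (f g : M ⟶ N) : Hom.hom (f + g) = f.hom + g.hom := rfl

instance (M N : RMod A) : AddCommGroup (M ⟶ N) :=
  (hom_injective M N).addCommGroup _ rfl (fun _ _ => rfl) (fun _ => rfl) (fun _ _ => rfl)
    (fun _ _ => rfl) (fun _ _ => rfl)

instance : Preadditive (RMod A) where
  add_comp _ _ _ _ _ _ := by ext; simp
  comp_add _ _ _ _ _ _ := by ext; simp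

variable {k : Type w} [Field k] [Linear k C] [MonoidalLinear k C]

instance (M N : RMod A) : SMul k (M ⟶ N) :=
  ⟨fun r f => ⟨r • f.hom, by simp [f.act_hom]⟩⟩

@[simp] lemma smul_hom {M N : RMod A} (r : k) (f : M ⟶ N) :
    Hom.hom (r • f) = r • f.hom := rfl

/-- Passing to the underlying morphism, as an additive map. -/
def homAddMonoidHom (M N : RMod A) : (M ⟶ N) →+ (M.X ⟶ N.X) where
  toFun f := f.hom
  map_zero' := rfl
  map_add' _ _ := rfl

instance (M N : RMod A) : Module k (M ⟶ N) :=
  Function.Injective.module k (homAddMonoidHom M N) (hom_injective M N) (fun _ _ => rfl)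

instance : Linear k (RMod A) where
  smul_comp _ _ _ _ _ _ := by ext; simp
  comp_smul _ _ _ _ _ _ := by ext; simp

end Linear

end RMod

/-! ### Separable algebras -/

section Separable

variable {C : Type u} [Category.{v} C] [MonoidalCategory C]

/-- The `A`-`A`-bimodule `A ⊗ A`, with `A` acting on the left of the first factor and on the right
of the second factor. -/
@[simps]
def tensorSquare (A : Mon C) : Bimod A A where
  X := A.X ⊗ A.X
  actLeft := (α_ A.X A.X A.X).inv ≫ μ ▷ A.X
  actRight := (α_ A.X A.X A.X).hom ≫ A.X ◁ μ
  one_actLeft := by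
    rw [associator_inv_naturality_left_assoc, ← comp_whiskerRight, one_mul]
    simp
  left_assoc := by
    rw [associator_inv_naturality_left_assoc, ← comp_whiskerRight, mul_assoc]
    simp
  actRight_one := by
    rw [associator_naturality_right_assoc, ← whiskerLeft_comp, mul_one]
    simp
  right_assoc := by
    rw [associator_naturality_right_assoc, ← whiskerLeft_comp, mul_assoc_flip]
    simp only [MonoidalCategory.whiskerLeft_comp, comp_whiskerRight, Category.assoc]
    monoidal
  middle_assoc := by
    simp only [comp_whiskerRight, MonoidalCategory.whiskerLeft_comp, Category.assoc]
    rw [associator_naturality_left_assoc, ← whisker_exchange]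
    monoidal

/-- The multiplication of `A` as a map of `A`-`A`-bimodules `A ⊗ A ⟶ A`. -/
def mulBimod (A : Mon C) : tensorSquare A ⟶ Bimod.regular A where
  hom := μ
  left_act_hom := by
    dsimp only [tensorSquare, Bimod.regular]
    rw [Category.assoc, mul_assoc, Iso.inv_hom_id_assoc]
  right_act_hom := by
    dsimp only [tensorSquare, Bimod.regular]
    rw [Category.assoc, ← mul_assoc]

/-- An algebra is separable if its multiplication splits as a map of bimodules. -/
def IsSeparable (A : Mon C) : Prop := IsSplitEpi (mulBimod A)

end Separable

/-! ### Simple algebras, division algebras, matrix algebras, Morita equivalence -/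

section Algebras

attribute [local instance] Abelian.hasFiniteBiproducts

variable {C : Type u} [Category.{v} C] [Abelian C] [MonoidalCategory C] [MonoidalPreadditive C]

/-- `A` is simple if the left `C`-module category of right `A`-modules is semisimple and
indecomposable. -/
def IsSimpleAlgebra (k : Type w) [Field k] [Linear k C] [MonoidalLinear k C] (A : Mon C) : Prop :=
  IsSemisimpleCategory k (RMod A) ∧ IsIndecomposableModule C (RMod A)

/-- `A` is a division algebra if it is simple as a right module over itself. -/
def IsDivisionAlgebra (A : Mon C) : Prop := Simple (RMod.regular A)

/-- `A` is the direct sum of the algebras `B i` (possibly none): the components of an isomorphism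
from `A` to the biproduct of the `B i` in `C` are algebra maps, i.e. the multiplication and the
unit are componentwise. -/
def IsDirectSum (A : Mon C) {m : ℕ} (B : Fin m → Mon C) : Prop :=
  ∃ p : ∀ i, A ⟶ B i, IsIso (biproduct.lift (fun i => (p i).hom) : A.X ⟶ ⨁ fun i => (B i).X)

variable [RigidCategory C]

/-- A bimodule is invertible if it has a two-sided inverse, up to isomorphism, for the relative
tensor product. -/
def IsInvertibleBimod {A B : Mon C} (P : Bimod A B) : Prop :=
  ∃ Q : Bimod B A, Nonempty (P.tensorBimod Q ≅ Bimod.regular A) ∧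
    Nonempty (Q.tensorBimod P ≅ Bimod.regular B)

/-- Two algebras are Morita equivalent if there is an invertible bimodule between them. -/
def MoritaEquivalent (A B : Mon C) : Prop := ∃ P : Bimod A B, IsInvertibleBimod P

/-- The canonical map `P ⊗ Q ⟶ P ⊗_B Q`. -/
def tensorProj {A B D : Mon C} (P : Bimod A B) (Q : Bimod B D) :
    P.X ⊗ Q.X ⟶ (P.tensorBimod Q).X :=
  coequalizer.π _ _

/-- A decomposition `A ≅ ⨁ A_{ij}`, with `1 ≤ i, j ≤ n + 1`, exhibiting `A` as a matrix algebra.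
The algebra `A_{ii}` is `diag i`, and `A_{ij}` is the bimodule `entry i j`. -/
structure MatrixDecomposition (k : Type w) [Field k] [Linear k C] [MonoidalLinear k C]
    (A : Mon C) where
  n : ℕ
  diag : Fin (n + 1) → Mon C
  diag_simple : ∀ i, IsSimpleAlgebra k (diag i)
  diag_division : ∀ i, IsDivisionAlgebra (diag i)
  entry : ∀ i j, Bimod (diag i) (diag j)
  /-- the diagonal entry is the algebra `A_{ii}`, as a bimodule over itself -/
  entry_self : ∀ i, entry i i ≅ Bimod.regular (diag i)
  entry_invertible : ∀ i j, IsInvertibleBimod (entry i j)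
  /-- the isomorphism of bimodules `A_{ij} ⊗_{A_{jj}} A_{jl} ≅ A_{il}` -/
  compIso : ∀ i j l, (entry i j).tensorBimod (entry j l) ≅ entry i l
  /-- the decomposition in `C` -/
  decomp : A.X ≅ ⨁ fun p : Fin (n + 1) × Fin (n + 1) => (entry p.1 p.2).X
  /-- on `A_{ij} ⊗ A_{jl}` the multiplication of `A` is induced by `compIso i j l` -/
  mul_comp : ∀ i j l,
    ((biproduct.ι (fun p : Fin (n + 1) × Fin (n + 1) => (entry p.1 p.2).X) (i, j) ≫ decomp.inv) ⊗ₘ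
      (biproduct.ι (fun p : Fin (n + 1) × Fin (n + 1) => (entry p.1 p.2).X) (j, l) ≫ decomp.inv)) ≫
      μ =
    tensorProj (entry i j) (entry j l) ≫ (compIso i j l).hom.hom ≫
      biproduct.ι (fun p : Fin (n + 1) × Fin (n + 1) => (entry p.1 p.2).X) (i, l) ≫ decomp.inv
  /-- on `A_{ij} ⊗ A_{j'l}` with `j ≠ j'` the multiplication of `A` is zero -/
  mul_zero : ∀ i j j' l, j ≠ j' →
    ((biproduct.ι (fun p : Fin (n + 1) × Fin (n + 1) => (entry p.1 p.2).X) (i, j) ≫ decomp.inv) ⊗ₘ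
      (biproduct.ι (fun p : Fin (n + 1) × Fin (n + 1) => (entry p.1 p.2).X) (j', l) ≫
        decomp.inv)) ≫ μ = 0

/-- `A` is a matrix algebra if it admits a decomposition as above. -/
def IsMatrixAlgebra (k : Type w) [Field k] [Linear k C] [MonoidalLinear k C] (A : Mon C) : Prop :=
  Nonempty (MatrixDecomposition k A)


end Algebras

end MultiFusion

end

/-! The ordinary structure theory of semisimple rings is carried out inside `C`, with semisimplicity
used mainly in the form of von Neumann regularity: every morphism `f` has some `g` with `f ≫ g ≫ f =
f`. In particular every epimorphism splits and idempotents can be refined until they are minimal.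

A bimodule section of the multiplication is a separability element, and averaging with it turns a
morphism of `C` between two `A`-modules into a module map (`RMod.average`). Averaging a generalized
inverse in `C` of a module map gives a generalized inverse among module maps, so the right modules
over a separable `A` are again von Neumann regular. Hence the right module `A` splits into finitely
many minimal pieces `e_i A`. If `e_i A e_j` is nonzero, minimality gives `e_i ∈ A e_j A`
(`IsMinimal.isGeneratedBy`), and on minimal idempotents this relation is an equivalence. The sum of
each class is a central idempotent, so `A` is the direct sum of the algebras `e A e` for these sums.
Inside one class the multiplications `e_i A e_j ⊗ e_j A e_l ⟶ e_i A e_l` become isomorphisms over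
`e_j A e_j` (`IsGeneratedBy.isIso_relComp`), and each `e_i A e_i` is a division algebra, which is
the matrix structure. Conversely, sections of the multiplications of direct summands add up.

Morita invariance rests on relative projectivity: over a separable `A`, every bimodule map onto `A`
that is epi in `C` splits (`IsSeparable.isSplitEpi`). For an invertible `P` with inverse `Q`, the
multiplication of `B` tensored with `P` on the left and `Q` on the right is such a map. It therefore
splits, and tensoring with invertible bimodules reflects split epimorphisms.

For a matrix algebra, let `e` be the idempotent cutting out the first diagonal entry. The products
`A_{i1} ⊗ A_{1j} ⟶ A_{ij}` are epi, so `1 ∈ A e A` and `A` is Morita equivalent to `e A e`. The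
latter is isomorphic to `A_{11}` as an algebra (`nonempty_diag_iso`), although the given data
identify the two only up to a central twist. The simplicity of the diagonal algebras comes from
regularity and a finite generator of their module category. -/

noncomputable section

namespace MultiFusion

/-! ### Von Neumann regular categories and minimal idempotents -/

/-- Every morphism of the category has a generalized inverse. -/
def IsVonNeumannRegular (M : Type u₁) [Category.{v₁} M] : Prop :=
  ∀ ⦃X Y : M⦄ (f : X ⟶ Y), ∃ g : Y ⟶ X, f ≫ g ≫ f = f

lemma IsVonNeumannRegular.isSplitEpi {M : Type u₁} [Category.{v₁} M] (h : IsVonNeumannRegular M)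
    {X Y : M} (f : X ⟶ Y) [Epi f] : IsSplitEpi f := by
  obtain ⟨g, hg⟩ := h f
  exact ⟨⟨⟨g, by rw [← cancel_epi f, hg, Category.comp_id]⟩⟩⟩

/-- A nonzero idempotent `e` such that every nonzero map into the image of `e` is a split
epimorphism onto it. -/
structure IsMinimalIdempotent {M : Type u₁} [Category.{v₁} M] [Preadditive M] {A : M}
    (e : A ⟶ A) : Prop where
  idem : e ≫ e = e
  ne_zero : e ≠ 0
  exists_lift : ∀ ⦃Y : M⦄ (f : Y ⟶ A), f ≠ 0 → f ≫ e = f → ∃ h : A ⟶ Y, h ≫ f = e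

section Idempotents

variable {k : Type w} [Field k] {M : Type u₁} [Category.{v₁} M] [Preadditive M]

/-- A nonzero idempotent that is not minimal dominates a proper nonzero idempotent. -/
lemma exists_proper_idempotent (reg : IsVonNeumannRegular M) {A : M} {e : A ⟶ A}
    (idem : e ≫ e = e) (ne : e ≠ 0) (h : ¬ IsMinimalIdempotent e) :
    ∃ f : A ⟶ A, f ≫ f = f ∧ e ≫ f = f ∧ f ≫ e = f ∧ f ≠ 0 ∧ f ≠ e := by
  by_contra! H
  refine h ⟨idem, ne, fun Y f f0 fe => ?_⟩
  obtain ⟨g, hg⟩ := reg f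
  have h1 : (e ≫ g ≫ f) ≫ e = e ≫ g ≫ f := by simp [fe]
  -- The idempotent `e ≫ g ≫ f` lies below `e`, and this identity shows that it is nonzero, so by
  -- assumption it equals `e`.
  have h2 : f ≫ e ≫ g ≫ f = f := by rw [reassoc_of% fe, hg]
  refine ⟨e ≫ g, ?_⟩
  rw [Category.assoc]
  refine H (e ≫ g ≫ f) (by simp [reassoc_of% fe, hg]) (by simp [reassoc_of% idem]) h1 ?_
  intro h0
  rw [h0] at h2
  exact f0 (by simpa using h2.symm)

variable [Linear k M]

/-- Induction on the dimension of the space of endomorphisms factoring through `e`. A nonminimal `e`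
splits as `f + (e - f)`, and both parts have strictly smaller spaces. -/
lemma exists_minimal_decomposition_of_idempotent (k : Type w) [Field k] [Linear k M]
    (reg : IsVonNeumannRegular M) {A : M}
    [Module.Finite k (A ⟶ A)] (d : ℕ) : ∀ e : A ⟶ A, e ≫ e = e →
    Module.finrank k (LinearMap.range (Linear.rightComp k A e)) ≤ d →
    ∃ (J : Type) (_ : Fintype J) (f : J → (A ⟶ A)), (∀ i, IsMinimalIdempotent (f i)) ∧
      (∀ i j, i ≠ j → f i ≫ f j = 0) ∧ ∑ i, f i = e := by
  induction d with
  | zero =>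
    intro e he hd
    have : e ∈ LinearMap.range (Linear.rightComp k A e) := ⟨e, he⟩
    rw [Submodule.finrank_eq_zero.1 (Nat.le_zero.1 hd), Submodule.mem_bot] at this
    exact ⟨PEmpty, inferInstance, PEmpty.elim, fun i => i.elim, fun i => i.elim, by simp [this]⟩
  | succ d ih =>
    intro e he hd
    by_cases h0 : e = 0
    · exact ⟨PEmpty, inferInstance, PEmpty.elim, fun i => i.elim, fun i => i.elim, by simp [h0]⟩
    by_cases hm : IsMinimalIdempotent e
    · exact ⟨Unit, inferInstance, fun _ => e, fun _ => hm, fun i j h => (h rfl).elim, by simp⟩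
    obtain ⟨f, ff, ef, fe, f0, fne⟩ := exists_proper_idempotent reg he h0 hm
    have key : ∀ g : A ⟶ A, g ≫ g = g → g ≫ e = g → e ≫ g ≠ e →
        Module.finrank k (LinearMap.range (Linear.rightComp k A g)) ≤ d := by
      intro g gg ge hg
      refine Nat.lt_succ_iff.1 (lt_of_lt_of_le (Submodule.finrank_lt_finrank_of_lt ?_) hd)
      refine lt_of_le_of_ne ?_ ?_
      · rintro _ ⟨x, rfl⟩
        exact ⟨x ≫ g, by simp [ge]⟩
      -- If the two ranges agreed, then `e = x ≫ g` for some `x`, which forces `e ≫ g = e`.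
      · intro h
        have : e ∈ LinearMap.range (Linear.rightComp k A g) := by rw [h]; exact ⟨e, he⟩
        obtain ⟨x, hx⟩ := this
        have hx : x ≫ g = e := hx
        apply hg
        rw [← hx, Category.assoc, gg]
    obtain ⟨J₁, _, f₁, m₁, o₁, s₁⟩ := ih f ff (key f ff fe (by rwa [ef]))
    have gg : (e - f) ≫ (e - f) = e - f := by simp [he, ef, fe, ff]
    obtain ⟨J₂, _, f₂, m₂, o₂, s₂⟩ := ih (e - f) gg (key _ gg (by simp [he, fe])
      (by simpa [he, ef] using f0))
    have a₁ : ∀ i, f₁ i ≫ f = f₁ i := fun i => by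
      rw [← s₁, Preadditive.comp_sum, Finset.sum_eq_single i (fun j _ h => o₁ i j h.symm) (by simp),
        (m₁ i).idem]
    have b₁ : ∀ i, f ≫ f₁ i = f₁ i := fun i => by
      rw [← s₁, Preadditive.sum_comp, Finset.sum_eq_single i (fun j _ h => o₁ j i h) (by simp),
        (m₁ i).idem]
    have a₂ : ∀ i, f₂ i ≫ (e - f) = f₂ i := fun i => by
      rw [← s₂, Preadditive.comp_sum, Finset.sum_eq_single i (fun j _ h => o₂ i j h.symm) (by simp),
        (m₂ i).idem]
    have b₂ : ∀ i, (e - f) ≫ f₂ i = f₂ i := fun i => by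
      rw [← s₂, Preadditive.sum_comp, Finset.sum_eq_single i (fun j _ h => o₂ j i h) (by simp),
        (m₂ i).idem]
    refine ⟨J₁ ⊕ J₂, inferInstance, Sum.elim f₁ f₂, ?_, ?_, ?_⟩
    · rintro (i | i)
      exacts [m₁ i, m₂ i]
    · rintro (i | i) (j | j) h
      · exact o₁ i j (fun h' => h (by rw [h']))
      · dsimp
        rw [← a₁, ← b₂]
        simp [reassoc_of% fe, reassoc_of% ff]
      · dsimp
        rw [← a₂, ← b₁]
        simp [reassoc_of% ef, reassoc_of% ff]
      · exact o₂ i j (fun h' => h (by rw [h']))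
    · simp [s₁, s₂]

/-- The identity is a finite sum of orthogonal minimal idempotents. -/
lemma exists_minimal_decomposition (k : Type w) [Field k] [Linear k M]
    (reg : IsVonNeumannRegular M) (A : M) [Module.Finite k (A ⟶ A)] :
    ∃ (J : Type) (_ : Fintype J) (f : J → (A ⟶ A)), (∀ i, IsMinimalIdempotent (f i)) ∧
      (∀ i j, i ≠ j → f i ≫ f j = 0) ∧ ∑ i, f i = 𝟙 A :=
  exists_minimal_decomposition_of_idempotent k reg _ _ (Category.comp_id _) le_rfl

end Idempotents

end MultiFusion

end

noncomputable section

namespace MultiFusion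

/-! ### An intrinsic characterization of semisimple categories -/

/-- Every object is a retract of a finite direct sum of copies of `T`. -/
def IsFiniteGenerator {M : Type u₁} [Category.{v₁} M] [Preadditive M] (T : M) : Prop :=
  ∀ X : M, ∃ (n : ℕ) (a : Fin n → (T ⟶ X)) (b : Fin n → (X ⟶ T)), ∑ i, b i ≫ a i = 𝟙 X

/-! ### Finitely generated modules over a semisimple ring -/

section FGModuleCat

variable {S : Type w} [Ring S]

/-- A generalized inverse of `f` is a projection onto its range followed by a section of `f` over
the range. Both exist by semisimplicity. -/
lemma FGModuleCat.isVonNeumannRegular [IsSemisimpleRing S] :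
    IsVonNeumannRegular (FGModuleCat.{w} S) := by
  intro V W f
  obtain ⟨s, hs⟩ := IsSemisimpleModule.lifting_property f.hom.hom.rangeRestrict
    f.hom.hom.surjective_rangeRestrict LinearMap.id
  obtain ⟨p, hp⟩ := IsSemisimpleModule.extension_property (LinearMap.range f.hom.hom).subtype
    Subtype.val_injective LinearMap.id
  refine ⟨FGModuleCat.ofHom (s ∘ₗ p), ?_⟩
  ext x
  have h1 : p (f.hom.hom x) = f.hom.hom.rangeRestrict x :=
    LinearMap.congr_fun hp (f.hom.hom.rangeRestrict x)
  have h2 := congrArg Subtype.val (LinearMap.congr_fun hs (f.hom.hom.rangeRestrict x))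
  change f.hom.hom (s (p (f.hom.hom x))) = f.hom.hom x
  rw [h1]
  exact h2

lemma FGModuleCat.isFiniteGenerator [IsSemisimpleRing S] :
    IsFiniteGenerator (FGModuleCat.of S S) := by
  intro V
  obtain ⟨n, π, hπ⟩ := Module.Finite.exists_fin' S V
  obtain ⟨s, hs⟩ := IsSemisimpleModule.lifting_property π hπ LinearMap.id
  refine ⟨n, fun i => FGModuleCat.ofHom (π ∘ₗ LinearMap.single S (fun _ => S) i),
    fun i => FGModuleCat.ofHom (LinearMap.proj i ∘ₗ s), ?_⟩
  have key : ∑ i, (π ∘ₗ LinearMap.single S (fun _ => S) i) ∘ₗ (LinearMap.proj i ∘ₗ s) =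
      LinearMap.id := by
    ext x
    simp only [LinearMap.sum_apply, LinearMap.comp_apply, LinearMap.id_apply, LinearMap.proj_apply]
    rw [← map_sum]
    have : ∑ i, LinearMap.single S (fun _ => S) i (s x i) = s x := by
      ext j
      simp [Finset.sum_apply, Pi.single_apply]
    rw [this]
    exact LinearMap.congr_fun hs x
  let Φ : (V →ₗ[S] V) →+ (V ⟶ V) :=
    { toFun := fun f => FGModuleCat.ofHom f
      map_zero' := rfl
      map_add' := fun _ _ => rfl }
  have := congrArg Φ key
  rw [map_sum] at this
  exact this

open scoped ModuleCat in
lemma FGModuleCat.finite_hom {k : Type w} [Field k] [Algebra k S] [Module.Finite k S]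
    (V W : FGModuleCat.{w} S) : Module.Finite k (V ⟶ W) := by
  have := Module.Finite.trans (R := k) S V.obj
  have := Module.Finite.trans (R := k) S W.obj
  let Φ : (V ⟶ W) →ₗ[k] (V.obj →ₗ[k] W.obj) :=
    { toFun := fun f => f.hom.hom.restrictScalars k
      map_add' := fun _ _ => rfl
      map_smul' := fun _ _ => rfl }
  refine Module.Finite.of_injective Φ fun f g h => ?_
  ext x
  exact LinearMap.congr_fun h x

end FGModuleCat

/-! ### Transport of regularity, generators and finiteness along equivalences -/

section Transport

variable {M : Type u₁} [Category.{v₁} M]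

lemma IsVonNeumannRegular.of_equivalence {N : Type*} [Category* N] (e : M ≌ N)
    (h : IsVonNeumannRegular N) : IsVonNeumannRegular M := by
  intro X Y f
  obtain ⟨g, hg⟩ := h (e.functor.map f)
  refine ⟨e.functor.preimage g, e.functor.map_injective ?_⟩
  simpa using hg

lemma IsFiniteGenerator.of_equivalence [Preadditive M] {N : Type*} [Category* N] [Preadditive N]
    (e : M ≌ N) [e.functor.Additive] {T : N} (h : IsFiniteGenerator T) :
    IsFiniteGenerator (e.inverse.obj T) := by
  intro X
  obtain ⟨n, a, b, hab⟩ := h (e.functor.obj X)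
  have := e.inverse_additive
  refine ⟨n, fun i => e.inverse.map (a i) ≫ e.unitInv.app X,
    fun i => e.unit.app X ≫ e.inverse.map (b i), ?_⟩
  have h1 := congrArg (fun f => e.unit.app X ≫ e.inverse.map f ≫ e.unitInv.app X) hab
  simpa [Functor.map_sum, Preadditive.comp_sum, Preadditive.sum_comp] using h1

variable {k : Type w} [Field k] [Preadditive M] [Linear k M]

lemma IsSemisimpleCategory.isVonNeumannRegular (h : IsSemisimpleCategory k M) :
    IsVonNeumannRegular M := by
  obtain ⟨R, _, _, _, _, e, _, _⟩ := h
  exact .of_equivalence e FGModuleCat.isVonNeumannRegular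

lemma IsSemisimpleCategory.exists_isFiniteGenerator (h : IsSemisimpleCategory k M) :
    ∃ T : M, IsFiniteGenerator T := by
  obtain ⟨R, _, _, _, _, e, _, _⟩ := h
  exact ⟨_, .of_equivalence e FGModuleCat.isFiniteGenerator⟩

lemma IsSemisimpleCategory.finite_hom (h : IsSemisimpleCategory k M) (X Y : M) :
    Module.Finite k (X ⟶ Y) := by
  obtain ⟨R, _, _, _, _, e, _, _⟩ := h
  have := FGModuleCat.finite_hom (k := k) (e.functor.obj X) (e.functor.obj Y)
  exact Module.Finite.of_injective (e.functor.mapLinearMap k) e.functor.map_injective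

end Transport

/-! ### Reconstruction of a semisimple category from a finite generator -/

section Converse

variable {k : Type w} [Field k] {M : Type u₁} [Category.{v₁} M] [Preadditive M] [Linear k M]

/-- A von Neumann regular Artinian ring is semisimple. -/
lemma isSemisimpleRing_of_regular {R : Type*} [Ring R] [IsArtinianRing R]
    (reg : ∀ f : R, ∃ g, f * (g * f) = f) : IsSemisimpleRing R := by
  rw [IsArtinianRing.isSemisimpleRing_iff_jacobson, eq_bot_iff]
  intro f hf
  obtain ⟨g, hg⟩ := reg f
  rw [← Ideal.jacobson_bot, Ideal.mem_jacobson_iff] at hf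
  obtain ⟨z, hz⟩ := hf (-g)
  rw [Ideal.mem_bot] at hz
  -- As `f` lies in the Jacobson radical, `1 - g * f` has a left inverse. It also annihilates the
  -- idempotent `g * f`, which must therefore vanish.
  have h1 : z * (1 - g * f) = 1 := by
    rw [← sub_eq_zero, ← hz]; noncomm_ring
  have h2 : (1 - g * f) * (g * f) = 0 := by
    rw [sub_mul, _root_.one_mul, _root_.mul_assoc g f, hg, sub_self]
  have h3 : g * f = 0 := by
    rw [← _root_.one_mul (g * f), ← h1, _root_.mul_assoc, h2, MulZeroClass.mul_zero]
  rw [Submodule.mem_bot, ← hg, h3, MulZeroClass.mul_zero]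

variable {R : Type w} [Ring R] {T : M} [∀ X : M, Small.{w} (T ⟶ X)]

/-- The morphisms from `T` to `X`, in the universe `w`, as a right module over a ring `R` that is
identified with the endomorphism ring of `T`. -/
@[nolint unusedArguments]
def HomModule (_ : R ≃+* End T) (X : M) : Type w := Shrink.{w} (T ⟶ X)

namespace HomModule

variable (φ : R ≃+* End T)

instance (X : M) : AddCommGroup (HomModule φ X) := inferInstanceAs (AddCommGroup (Shrink _))

/-- The tautological identification. -/
def equiv (X : M) : HomModule φ X ≃+ (T ⟶ X) := Shrink.addEquiv

instance (X : M) : Module Rᵐᵒᵖ (HomModule φ X) where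
  smul r x := (equiv φ X).symm (End.asHom (φ r.unop) ≫ equiv φ X x)
  one_smul x := by
    change (equiv φ X).symm (End.asHom (φ 1) ≫ equiv φ X x) = x
    rw [map_one]
    exact (congrArg _ (Category.id_comp _)).trans ((equiv φ X).symm_apply_apply x)
  mul_smul r s x := by
    change (equiv φ X).symm (End.asHom (φ (s.unop * r.unop)) ≫ equiv φ X x) =
      (equiv φ X).symm (End.asHom (φ r.unop) ≫ equiv φ X ((equiv φ X).symm
        (End.asHom (φ s.unop) ≫ equiv φ X x)))
    rw [map_mul, AddEquiv.apply_symm_apply, ← Category.assoc]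
    rfl
  smul_zero r := by
    change (equiv φ X).symm _ = _
    simp
  smul_add r x y := by
    change (equiv φ X).symm _ = (equiv φ X).symm _ + (equiv φ X).symm _
    simp
  add_smul r s x := by
    change (equiv φ X).symm (End.asHom (φ (r.unop + s.unop)) ≫ equiv φ X x) =
      (equiv φ X).symm _ + (equiv φ X).symm _
    rw [map_add φ, ← map_add (equiv φ X).symm]
    exact congrArg _ (Preadditive.add_comp _ _ _ _ _ _)
  zero_smul x := by
    change (equiv φ X).symm (End.asHom (φ 0) ≫ equiv φ X x) = 0
    rw [map_zero]
    exact (congrArg _ zero_comp).trans (map_zero _)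

lemma equiv_smul {X : M} (r : Rᵐᵒᵖ) (x : HomModule φ X) :
    equiv φ X (r • x) = End.asHom (φ r.unop) ≫ equiv φ X x :=
  (equiv φ X).apply_symm_apply _

lemma symm_comp {X : M} (f : T ⟶ T) (g : T ⟶ X) :
    (equiv φ X).symm (f ≫ g) = MulOpposite.op (φ.symm (End.of f)) • (equiv φ X).symm g := by
  apply (equiv φ X).injective
  rw [equiv_smul, AddEquiv.apply_symm_apply, AddEquiv.apply_symm_apply, MulOpposite.unop_op,
    RingEquiv.apply_symm_apply]

/-- Postcomposition, as a linear map. -/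
def map {X Y : M} (f : X ⟶ Y) : HomModule φ X →ₗ[Rᵐᵒᵖ] HomModule φ Y where
  toFun x := (equiv φ Y).symm (equiv φ X x ≫ f)
  map_add' x y := by simp
  map_smul' r x := by
    apply (equiv φ Y).injective
    simp [equiv_smul]

@[simp] lemma equiv_map {X Y : M} (f : X ⟶ Y) (x : HomModule φ X) :
    equiv φ Y (map φ f x) = equiv φ X x ≫ f :=
  (equiv φ Y).apply_symm_apply _

lemma finite (gen : IsFiniteGenerator T) (X : M) : Module.Finite Rᵐᵒᵖ (HomModule φ X) := by
  classical
  obtain ⟨n, a, b, hab⟩ := gen X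
  refine ⟨⟨Finset.univ.image fun i => (equiv φ X).symm (a i), eq_top_iff.2 fun x _ => ?_⟩⟩
  have : x = ∑ i, (equiv φ X).symm ((equiv φ X x ≫ b i) ≫ a i) := by
    rw [← map_sum]
    simp_rw [Category.assoc]
    rw [← Preadditive.comp_sum, hab, Category.comp_id, AddEquiv.symm_apply_apply]
  rw [this]
  refine Submodule.sum_mem _ fun i _ => ?_
  rw [symm_comp]
  exact Submodule.smul_mem _ _ (Submodule.subset_span (by simp))

/-- The functor `X ↦ Hom(T, X)` to finitely generated right `R`-modules. -/
def functor (gen : IsFiniteGenerator T) : M ⥤ FGModuleCat.{w} Rᵐᵒᵖ where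
  obj X :=
    have := finite φ gen X
    FGModuleCat.of Rᵐᵒᵖ (HomModule φ X)
  map f := ⟨ModuleCat.ofHom (map φ f)⟩
  map_id X := by
    ext x
    apply (equiv φ X).injective
    exact (equiv_map φ _ _).trans (Category.comp_id _)
  map_comp {X Y Z} f g := by
    ext x
    apply (equiv φ Z).injective
    refine (equiv_map φ _ _).trans ?_
    refine Eq.trans ?_ (equiv_map φ _ _).symm
    rw [← Category.assoc]
    exact congrArg (· ≫ g) (equiv_map φ f x).symm

lemma faithful (gen : IsFiniteGenerator T) : (functor φ gen).Faithful where
  map_injective {X Y} f g h := by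
    obtain ⟨n, a, b, hab⟩ := gen X
    rw [← Category.id_comp f, ← Category.id_comp g, ← hab, Preadditive.sum_comp,
      Preadditive.sum_comp]
    refine Finset.sum_congr rfl fun i _ => ?_
    have h1 : map φ f = map φ g := congrArg (fun t => t.hom.hom) h
    have h2 := congrArg (equiv φ Y) (LinearMap.congr_fun h1 ((equiv φ X).symm (a i)))
    rw [equiv_map, equiv_map, AddEquiv.apply_symm_apply] at h2
    rw [Category.assoc, h2, Category.assoc]

lemma full (gen : IsFiniteGenerator T) : (functor φ gen).Full where
  map_surjective {X Y} t := by
    obtain ⟨n, a, b, hab⟩ := gen X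
    let t' : HomModule φ X →ₗ[Rᵐᵒᵖ] HomModule φ Y := t.hom.hom
    -- Since `𝟙 X = ∑ b i ≫ a i`, a linear map is determined by its values on the `a i`, which
    -- generate `Hom(T, X)`.
    refine ⟨∑ i, b i ≫ equiv φ Y (t' ((equiv φ X).symm (a i))), ?_⟩
    have : map φ (∑ i, b i ≫ equiv φ Y (t' ((equiv φ X).symm (a i)))) = t' := by
      ext x
      apply (equiv φ Y).injective
      rw [equiv_map, Preadditive.comp_sum]
      have h1 : x = ∑ i, (equiv φ X).symm ((equiv φ X x ≫ b i) ≫ a i) := by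
        rw [← map_sum]
        simp_rw [Category.assoc]
        rw [← Preadditive.comp_sum, hab, Category.comp_id, AddEquiv.symm_apply_apply]
      conv_rhs => rw [h1, map_sum, map_sum]
      refine Finset.sum_congr rfl fun i _ => ?_
      rw [symm_comp, map_smul, equiv_smul, MulOpposite.unop_op, RingEquiv.apply_symm_apply,
        ← Category.assoc]
    exact FGModuleCat.hom_ext this

/-- A module with `n` generators is a quotient of `Hom(T, X)`, where `X` contains `n` copies of `T`.
By semisimplicity it is a retract, hence the image of an idempotent. That idempotent comes from `X`
by full faithfulness and splits there. -/
lemma essSurj [IsSemisimpleRing R] [IsIdempotentComplete M] (gen : IsFiniteGenerator T)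
    (sums : ∀ n : ℕ, ∃ (X : M) (i : Fin n → (T ⟶ X)) (p : Fin n → (X ⟶ T)),
      ∀ a b, i a ≫ p b = if a = b then 𝟙 T else 0) : (functor φ gen).EssSurj where
  mem_essImage V := by
    have := faithful φ gen
    have := full φ gen
    obtain ⟨n, v, hv⟩ := Module.Finite.exists_fin (R := Rᵐᵒᵖ) (M := V)
    obtain ⟨X, i, p, hip⟩ := sums n
    -- This map sends the inclusion `i b` to the generator `v b`, so it is surjective.
    let r : HomModule φ X →ₗ[Rᵐᵒᵖ] V :=
      { toFun := fun x => ∑ a, MulOpposite.op (φ.symm (End.of (equiv φ X x ≫ p a))) • v a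
        map_add' := fun x y => by
          rw [← Finset.sum_add_distrib]
          refine Finset.sum_congr rfl fun a _ => ?_
          rw [← add_smul, ← MulOpposite.op_add, ← map_add, map_add, Preadditive.add_comp]
        map_smul' := fun s x => by
          rw [Finset.smul_sum]
          refine Finset.sum_congr rfl fun a _ => ?_
          rw [smul_smul, equiv_smul, Category.assoc, RingHom.id_apply]
          congr 1
          apply MulOpposite.unop_injective
          rw [MulOpposite.unop_mul, MulOpposite.unop_op, MulOpposite.unop_op]
          apply φ.injective
          rw [map_mul, RingEquiv.apply_symm_apply, RingEquiv.apply_symm_apply]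
          rfl }
    have hr : Function.Surjective r := by
      rw [← LinearMap.range_eq_top, eq_top_iff, ← hv, Submodule.span_le]
      rintro _ ⟨b, rfl⟩
      refine ⟨(equiv φ X).symm (i b), ?_⟩
      change ∑ a, MulOpposite.op (φ.symm (End.of (equiv φ X ((equiv φ X).symm (i b)) ≫ p a))) • v a
        = v b
      rw [Finset.sum_eq_single b]
      · rw [AddEquiv.apply_symm_apply, hip, if_pos rfl]
        change MulOpposite.op (φ.symm 1) • v b = v b
        rw [map_one, MulOpposite.op_one, one_smul]
      · intro a _ hab
        rw [AddEquiv.apply_symm_apply, hip, if_neg hab.symm]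
        change MulOpposite.op (φ.symm 0) • v a = 0
        rw [map_zero, MulOpposite.op_zero, zero_smul]
      · simp
    obtain ⟨s, hs⟩ := IsSemisimpleModule.lifting_property r hr LinearMap.id
    let r' : (functor φ gen).obj X ⟶ V := ⟨ModuleCat.ofHom r⟩
    let s' : V ⟶ (functor φ gen).obj X := ⟨ModuleCat.ofHom s⟩
    have hsr : s' ≫ r' = 𝟙 V := FGModuleCat.hom_ext hs
    obtain ⟨Y, j, q, hjq, hqj⟩ := IsIdempotentComplete.idempotents_split X
      ((functor φ gen).preimage (r' ≫ s'))
      ((functor φ gen).map_injective (by simp [reassoc_of% hsr]))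
    have hqj' : (functor φ gen).map q ≫ (functor φ gen).map j = r' ≫ s' := by
      rw [← Functor.map_comp, hqj, Functor.map_preimage]
    have hjq' : (functor φ gen).map j ≫ (functor φ gen).map q = 𝟙 _ := by
      rw [← Functor.map_comp, hjq, CategoryTheory.Functor.map_id]
    refine ⟨Y, ⟨⟨(functor φ gen).map j ≫ r', s' ≫ (functor φ gen).map q, ?_, ?_⟩⟩⟩
    · rw [Category.assoc, ← Category.assoc r', ← hqj', Category.assoc, hjq', Category.comp_id, hjq']
    · rw [Category.assoc, ← Category.assoc _ _ r', hqj', Category.assoc, hsr, Category.comp_id, hsr]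

end HomModule

open scoped ModuleCat in
/-- A linear idempotent complete category with a finite generator whose endomorphism algebra is
finite-dimensional and von Neumann regular is semisimple. -/
lemma isSemisimpleCategory_of_isFiniteGenerator [IsIdempotentComplete M] (T : M)
    [∀ X, Module.Finite k (T ⟶ X)] (gen : IsFiniteGenerator T)
    (reg : ∀ f : T ⟶ T, ∃ g : T ⟶ T, f ≫ g ≫ f = f)
    (sums : ∀ n : ℕ, ∃ (X : M) (i : Fin n → (T ⟶ X)) (p : Fin n → (X ⟶ T)),
      ∀ a b, i a ≫ p b = if a = b then 𝟙 T else 0) : IsSemisimpleCategory k M := by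
  -- The algebra `R` of `IsSemisimpleCategory` must live in the universe of `k`. Finite-dimensional
  -- spaces have copies there.
  have small : ∀ X : M, Small.{w} (T ⟶ X) := fun X => Module.Finite.small k (T ⟶ X)
  have : Small.{w} (End T) := small T
  have fin : Module.Finite k (End T) := ‹∀ X, Module.Finite k (T ⟶ X)› T
  have : IsArtinianRing (End T) := IsArtinianRing.of_finite k (End T)
  have : IsSemisimpleRing (End T) := isSemisimpleRing_of_regular fun f => by
    obtain ⟨g, hg⟩ := reg (End.asHom f)
    exact ⟨End.of g, (Category.assoc _ _ _).trans hg⟩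
  let φ : Shrink.{w} (End T) ≃ₐ[k] End T := Shrink.algEquiv k (End T)
  have : IsSemisimpleRing (Shrink.{w} (End T)) := φ.symm.toRingEquiv.isSemisimpleRing
  have := HomModule.faithful φ.toRingEquiv gen
  have := HomModule.full φ.toRingEquiv gen
  have := HomModule.essSurj φ.toRingEquiv gen sums
  have : (HomModule.functor φ.toRingEquiv gen).IsEquivalence := {}
  refine ⟨Shrink.{w} (End T), inferInstance, inferInstance,
    Module.Finite.equiv φ.symm.toLinearEquiv,
    inferInstance, (HomModule.functor φ.toRingEquiv gen).asEquivalence, ⟨?_⟩, ⟨?_⟩⟩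
  · intro X Y f g
    ext x
    apply (HomModule.equiv φ.toRingEquiv Y).injective
    refine (HomModule.equiv_map _ _ _).trans ((Preadditive.comp_add _ _ _ _ _ _).trans ?_)
    refine Eq.trans ?_ (map_add _ _ _).symm
    exact congrArg₂ _ (HomModule.equiv_map _ _ _).symm (HomModule.equiv_map _ _ _).symm
  · intro X Y f r
    ext x
    apply (HomModule.equiv φ.toRingEquiv Y).injective
    refine (HomModule.equiv_map _ _ _).trans ((Linear.comp_smul _ _ _ _ _ _).trans ?_)
    have key (x : HomModule φ.toRingEquiv X) : r • HomModule.equiv φ.toRingEquiv X x ≫ f =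
        HomModule.equiv φ.toRingEquiv Y
          (algebraMap k (Shrink.{w} (End T))ᵐᵒᵖ r • HomModule.map φ.toRingEquiv f x) := by
      rw [HomModule.equiv_smul, HomModule.equiv_map, MulOpposite.algebraMap_apply,
        MulOpposite.unop_op]
      change _ = End.asHom (φ (algebraMap k _ r)) ≫ _
      rw [AlgEquiv.commutes, Algebra.algebraMap_eq_smul_one]
      exact ((congrArg _ (Category.id_comp _)).symm).trans (Linear.smul_comp _ _ _ _ _ _).symm
    exact key x

end Converse

end MultiFusion

end

noncomputable section

namespace MultiFusion

/-! ### Separable algebras: sections of the multiplication -/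

section Sections

variable {C : Type u} [Category.{v} C] [MonoidalCategory C]

/-- A section of the multiplication that is a map of bimodules. -/
structure IsBimodSection (A : Mon C) (s : A.X ⟶ A.X ⊗ A.X) : Prop where
  comp_mul : s ≫ μ = 𝟙 A.X
  left : μ ≫ s = A.X ◁ s ≫ (α_ A.X A.X A.X).inv ≫ μ ▷ A.X
  right : μ ≫ s = s ▷ A.X ≫ (α_ A.X A.X A.X).hom ≫ A.X ◁ μ

lemma isSeparable_iff (A : Mon C) : IsSeparable A ↔ ∃ s, IsBimodSection A s := by
  constructor
  · rintro ⟨⟨s, hs⟩⟩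
    exact ⟨s.hom, congrArg Bimod.Hom.hom hs, s.left_act_hom, s.right_act_hom⟩
  · rintro ⟨s, h⟩
    exact ⟨⟨⟨⟨s, h.left, h.right⟩, Bimod.hom_ext _ _ h.comp_mul⟩⟩⟩

lemma mul_whiskerRight_tensorHom {A B : Mon C} (p : A ⟶ B) :
    (α_ A.X A.X A.X).inv ≫ μ ▷ A.X ≫ (p.hom ⊗ₘ p.hom) =
      A.X ◁ (p.hom ⊗ₘ p.hom) ≫ p.hom ▷ (B.X ⊗ B.X) ≫ (α_ B.X B.X B.X).inv ≫ μ ▷ B.X := by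
  rw [← MonoidalCategory.tensorHom_def'_assoc, associator_inv_naturality_assoc, ← tensorHom_id,
    ← tensorHom_id, tensorHom_comp_tensorHom, tensorHom_comp_tensorHom, IsMonHom.mul_hom,
    Category.id_comp, Category.comp_id]

lemma whiskerLeft_mul_tensorHom {A B : Mon C} (p : A ⟶ B) :
    (α_ A.X A.X A.X).hom ≫ A.X ◁ μ ≫ (p.hom ⊗ₘ p.hom) =
      (p.hom ⊗ₘ p.hom) ▷ A.X ≫ (B.X ⊗ B.X) ◁ p.hom ≫ (α_ B.X B.X B.X).hom ≫ B.X ◁ μ := by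
  rw [← MonoidalCategory.tensorHom_def_assoc, associator_naturality_assoc, ← id_tensorHom,
    ← id_tensorHom, tensorHom_comp_tensorHom, tensorHom_comp_tensorHom, IsMonHom.mul_hom,
    Category.id_comp, Category.comp_id]

/-- `B` is a direct factor of the algebra `A`, with projection `p` and inclusion `j`. -/
structure IsDirectFactor {A B : Mon C} (p : A ⟶ B) (j : B.X ⟶ A.X) : Prop where
  comp : j ≫ p.hom = 𝟙 B.X
  left : A.X ◁ j ≫ μ = p.hom ▷ B.X ≫ μ ≫ j
  right : j ▷ A.X ≫ μ = B.X ◁ p.hom ≫ μ ≫ j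

namespace IsDirectFactor

variable {A B : Mon C} {p : A ⟶ B} {j : B.X ⟶ A.X}

lemma mul (h : IsDirectFactor p j) : (j ⊗ₘ j) ≫ μ = μ ≫ j := by
  rw [tensorHom_def', Category.assoc, h.right, ← MonoidalCategory.whiskerLeft_comp_assoc, h.comp,
    MonoidalCategory.whiskerLeft_id, Category.id_comp]

/-- The inclusion `j` is linear over `A`, which acts on `B` through `p`. Linearity over `B` can thus
be tested after precomposing with the split epimorphism `p` in the acting variable, where it becomes
linearity of `s` over `A`. -/
lemma isBimodSection (h : IsDirectFactor p j) {s : A.X ⟶ A.X ⊗ A.X} (hs : IsBimodSection A s) :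
    IsBimodSection B (j ≫ s ≫ (p.hom ⊗ₘ p.hom)) where
  comp_mul := by
    rw [Category.assoc, Category.assoc, ← IsMonHom.mul_hom, reassoc_of% hs.comp_mul, h.comp]
  left := by
    have : IsSplitEpi (p.hom ▷ B.X) := ⟨⟨⟨j ▷ B.X, by rw [← comp_whiskerRight, h.comp]; simp⟩⟩⟩
    rw [← cancel_epi (p.hom ▷ B.X), ← reassoc_of% h.left, reassoc_of% hs.left,
      ← whisker_exchange_assoc, MonoidalCategory.whiskerLeft_comp_assoc,
      MonoidalCategory.whiskerLeft_comp_assoc, mul_whiskerRight_tensorHom]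
  right := by
    have : IsSplitEpi (B.X ◁ p.hom) := ⟨⟨⟨B.X ◁ j, by
      rw [← MonoidalCategory.whiskerLeft_comp, h.comp]; simp⟩⟩⟩
    rw [← cancel_epi (B.X ◁ p.hom), ← reassoc_of% h.right, reassoc_of% hs.right,
      whisker_exchange_assoc, comp_whiskerRight_assoc, comp_whiskerRight_assoc,
      whiskerLeft_mul_tensorHom]

end IsDirectFactor

end Sections

/-! ### Averaging over a separable algebra -/

namespace RMod

section Averaging

variable {C : Type u} [Category.{v} C] [MonoidalCategory C] {A : Mon C}

/-- The map `n ⊗ a ↦ g(n s₁(a)) s₂(a)`. -/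
def preAverage (s : A.X ⟶ A.X ⊗ A.X) {M N : RMod A} (g : N.X ⟶ M.X) : N.X ⊗ A.X ⟶ M.X :=
  N.X ◁ s ≫ (α_ N.X A.X A.X).inv ≫ N.act ▷ A.X ≫ g ▷ A.X ≫ M.act

/-- The average of `g` is `n ↦ preAverage(n ⊗ 1)`. Left linearity of `s` moves `a` from the module
into the algebra variable, so averaging at `n a` gives `preAverage(n ⊗ a)`. By right linearity
`preAverage_act` gives the same value for the average at `n` times `a`. Together they say that the
average is a module map. -/
lemma act_preAverage {s : A.X ⟶ A.X ⊗ A.X} (hs : IsBimodSection A s) {M N : RMod A}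
    (g : N.X ⟶ M.X) : N.act ≫ (ρ_ N.X).inv ≫ N.X ◁ η ≫ preAverage s g = preAverage s g := by
  have h1 : N.act ▷ A.X ≫ preAverage s g =
      (α_ _ _ _).hom ≫ N.X ◁ μ ≫ preAverage s g := by
    dsimp only [preAverage]
    rw [← MonoidalCategory.whiskerLeft_comp_assoc, hs.left, ← whisker_exchange_assoc]
    simp only [MonoidalCategory.whiskerLeft_comp, Category.assoc]
    rw [associator_inv_naturality_middle_assoc, ← comp_whiskerRight_assoc (N.X ◁ μ), N.act_assoc]
    simp only [comp_whiskerRight, Category.assoc]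
    monoidal
  rw [rightUnitor_inv_naturality_assoc, ← whisker_exchange_assoc, h1,
    associator_naturality_right_assoc, ← MonoidalCategory.whiskerLeft_comp_assoc, MonObj.mul_one]
  monoidal

lemma preAverage_act {s : A.X ⟶ A.X ⊗ A.X} (hs : IsBimodSection A s) {M N : RMod A}
    (g : N.X ⟶ M.X) : ((ρ_ N.X).inv ≫ N.X ◁ η ≫ preAverage s g) ▷ A.X ≫ M.act =
      preAverage s g := by
  have h1 : preAverage s g ▷ A.X ≫ M.act = (α_ _ _ _).hom ≫ N.X ◁ μ ≫ preAverage s g := by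
    dsimp only [preAverage]
    rw [← MonoidalCategory.whiskerLeft_comp_assoc, hs.right]
    simp only [MonoidalCategory.whiskerLeft_comp, Category.assoc, comp_whiskerRight]
    rw [associator_inv_naturality_right_assoc, whisker_exchange_assoc, whisker_exchange_assoc,
      M.act_assoc]
    monoidal
  simp only [comp_whiskerRight, Category.assoc]
  rw [h1]
  simp only [whisker_assoc, Category.assoc, Iso.inv_hom_id_assoc]
  rw [← MonoidalCategory.whiskerLeft_comp_assoc, MonObj.one_mul]
  monoidal

/-- Averaging a morphism to a module map, for a bimodule section of the multiplication. -/
@[simps]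
def average {s : A.X ⟶ A.X ⊗ A.X} (hs : IsBimodSection A s) {M N : RMod A} (g : N.X ⟶ M.X) :
    N ⟶ M where
  hom := (ρ_ N.X).inv ≫ N.X ◁ η ≫ preAverage s g
  act_hom := by rw [act_preAverage hs, preAverage_act hs]

lemma whiskerRight_preAverage (s : A.X ⟶ A.X ⊗ A.X) {L M N : RMod A} (f : L ⟶ N)
    (g : N.X ⟶ M.X) : f.hom ▷ A.X ≫ preAverage s g = preAverage s (M := M) (f.hom ≫ g) := by
  dsimp only [preAverage]
  rw [← whisker_exchange_assoc, associator_inv_naturality_left_assoc, ← comp_whiskerRight_assoc,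
    ← f.act_hom]
  simp

lemma preAverage_comp (s : A.X ⟶ A.X ⊗ A.X) {L M N : RMod A} (f : M ⟶ L)
    (g : N.X ⟶ M.X) : preAverage s g ≫ f.hom = preAverage s (M := L) (g ≫ f.hom) := by
  dsimp only [preAverage]
  simp [f.act_hom]

lemma preAverage_id {s : A.X ⟶ A.X ⊗ A.X} (hs : IsBimodSection A s) (M : RMod A) :
    preAverage s (M := M) (𝟙 M.X) = M.act := by
  dsimp only [preAverage]
  rw [id_whiskerRight, Category.id_comp, ← M.act_assoc, ← MonoidalCategory.whiskerLeft_comp_assoc,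
    hs.comp_mul]
  simp

/-- Averaging commutes with composition by module maps on either side and fixes module maps, so the
average of `f g f = f` is `f` itself. -/
lemma comp_average_comp {s : A.X ⟶ A.X ⊗ A.X} (hs : IsBimodSection A s) {M N : RMod A} (f : M ⟶ N)
    (g : N.X ⟶ M.X) (hg : f.hom ≫ g ≫ f.hom = f.hom) : f ≫ average hs g ≫ f = f := by
  ext
  rw [comp_hom, comp_hom, average_hom, Category.assoc, Category.assoc, preAverage_comp,
    rightUnitor_inv_naturality_assoc, ← whisker_exchange_assoc, whiskerRight_preAverage, hg,
    ← Category.id_comp f.hom, ← preAverage_comp, preAverage_id hs, ← Category.assoc (M.X ◁ η),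
    M.act_one, Iso.inv_hom_id_assoc, Category.id_comp]

lemma isVonNeumannRegular (hC : IsVonNeumannRegular C) (hA : IsSeparable A) :
    IsVonNeumannRegular (RMod A) := by
  obtain ⟨s, hs⟩ := (isSeparable_iff A).1 hA
  intro M N f
  obtain ⟨g, hg⟩ := hC f.hom
  exact ⟨_, comp_average_comp hs f g hg⟩

end Averaging

end RMod

end MultiFusion

end

noncomputable section

namespace MultiFusion

/-! ### Direct sums of separable algebras -/

section DirectSum

attribute [local instance] Abelian.hasFiniteBiproducts

variable {C : Type u} [Category.{v} C] [MonoidalCategory C]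

namespace IsDirectFactor

variable {A B : Mon C} {p : A ⟶ B} {j : B.X ⟶ A.X}

/-- `A` acts on the factor `B` through `p`, so the section of `B`, extended to `A` by `p` and `j`,
stays linear over all of `A`. -/
lemma left_section (h : IsDirectFactor p j) {s : B.X ⟶ B.X ⊗ B.X} (hs : IsBimodSection B s) :
    A.X ◁ (p.hom ≫ s ≫ (j ⊗ₘ j)) ≫ (α_ A.X A.X A.X).inv ≫ μ ▷ A.X =
      μ ≫ p.hom ≫ s ≫ (j ⊗ₘ j) := by
  have h1 : A.X ◁ (j ⊗ₘ j) ≫ (α_ A.X A.X A.X).inv ≫ μ ▷ A.X =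
      p.hom ▷ (B.X ⊗ B.X) ≫ (α_ B.X B.X B.X).inv ≫ μ ▷ B.X ≫ (j ⊗ₘ j) := by
    rw [← id_tensorHom, associator_inv_naturality_assoc, ← tensorHom_id, tensorHom_comp_tensorHom,
      id_tensorHom, h.left, Category.comp_id, associator_inv_naturality_left_assoc,
      ← tensorHom_id μ, ← tensorHom_id (p.hom ▷ B.X), tensorHom_comp_tensorHom,
      tensorHom_comp_tensorHom, Category.id_comp, Category.id_comp]
  rw [MonoidalCategory.whiskerLeft_comp_assoc, MonoidalCategory.whiskerLeft_comp_assoc, h1,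
    whisker_exchange_assoc, whisker_exchange_assoc, ← reassoc_of% hs.left,
    ← MonoidalCategory.tensorHom_def_assoc, IsMonHom.mul_hom_assoc p.hom]

lemma right_section (h : IsDirectFactor p j) {s : B.X ⟶ B.X ⊗ B.X} (hs : IsBimodSection B s) :
    (p.hom ≫ s ≫ (j ⊗ₘ j)) ▷ A.X ≫ (α_ A.X A.X A.X).hom ≫ A.X ◁ μ =
      μ ≫ p.hom ≫ s ≫ (j ⊗ₘ j) := by
  have h1 : (j ⊗ₘ j) ▷ A.X ≫ (α_ A.X A.X A.X).hom ≫ A.X ◁ μ =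
      (B.X ⊗ B.X) ◁ p.hom ≫ (α_ B.X B.X B.X).hom ≫ B.X ◁ μ ≫ (j ⊗ₘ j) := by
    rw [← tensorHom_id, associator_naturality_assoc, ← id_tensorHom, tensorHom_comp_tensorHom,
      tensorHom_id, h.right, Category.comp_id, associator_naturality_right_assoc,
      ← id_tensorHom _ (B.X ◁ p.hom), ← id_tensorHom _ μ, tensorHom_comp_tensorHom,
      tensorHom_comp_tensorHom,
      Category.id_comp, Category.id_comp]
  rw [comp_whiskerRight_assoc, comp_whiskerRight_assoc, h1,
    ← whisker_exchange_assoc, ← whisker_exchange_assoc, ← reassoc_of% hs.right,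
    ← MonoidalCategory.tensorHom_def'_assoc, IsMonHom.mul_hom_assoc p.hom]

lemma isSeparable (h : IsDirectFactor p j) (hA : IsSeparable A) : IsSeparable B := by
  obtain ⟨s, hs⟩ := (isSeparable_iff A).1 hA
  exact (isSeparable_iff B).2 ⟨_, h.isBimodSection hs⟩

lemma of_iso (e : A ≅ B) : IsDirectFactor e.hom e.inv.hom := by
  have h1 : e.hom.hom ≫ e.inv.hom = 𝟙 A.X := congrArg Mon.Hom.hom e.hom_inv_id
  have h2 : e.inv.hom ≫ e.hom.hom = 𝟙 B.X := congrArg Mon.Hom.hom e.inv_hom_id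
  refine ⟨h2, ?_, ?_⟩
  · rw [IsMonHom.mul_hom, MonoidalCategory.tensorHom_def, Category.assoc,
      ← comp_whiskerRight_assoc, h1, id_whiskerRight, Category.id_comp]
  · rw [IsMonHom.mul_hom, MonoidalCategory.tensorHom_def', Category.assoc,
      ← MonoidalCategory.whiskerLeft_comp_assoc, h1, MonoidalCategory.whiskerLeft_id,
      Category.id_comp]

end IsDirectFactor

variable [Abelian C] [MonoidalPreadditive C]

/-- Each summand is a direct factor, and the sum over `i` of the extended sections `p i ≫ s i ≫ (j i
⊗ j i)` is a section for `A`. The identities making the summands direct factors are checked after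
the jointly monic projections `p k`. -/
lemma IsDirectSum.isSeparable {A : Mon C} {m : ℕ} {B : Fin m → Mon C} (h : IsDirectSum A B)
    (hB : ∀ i, IsSeparable (B i)) : IsSeparable A := by
  obtain ⟨p, _⟩ := h
  let F := biproduct.lift fun i => (p i).hom
  have hF : ∀ i, inv F ≫ (p i).hom = biproduct.π (fun i => (B i).X) i := fun i => by
    rw [IsIso.inv_comp_eq, biproduct.lift_π]
  let j : ∀ i, (B i).X ⟶ A.X := fun i => biproduct.ι (fun i => (B i).X) i ≫ inv F
  have jp : ∀ i k, j i ≫ (p k).hom = biproduct.ι (fun i => (B i).X) i ≫ biproduct.π _ k :=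
    fun i k => by rw [Category.assoc, hF]
  have jp0 : ∀ i k, i ≠ k → j i ≫ (p k).hom = 0 := fun i k h => by
    rw [jp, biproduct.ι_π_ne _ h]
  have jp1 : ∀ i, j i ≫ (p i).hom = 𝟙 _ := fun i => by rw [jp, biproduct.ι_π_self]
  have joint : ∀ {X : C} (f g : X ⟶ A.X), (∀ i, f ≫ (p i).hom = g ≫ (p i).hom) → f = g :=
    fun f g h => by
      rw [← cancel_mono F]
      refine biproduct.hom_ext _ _ fun i => ?_
      rw [Category.assoc, Category.assoc, biproduct.lift_π, h]
  have sum : ∑ i, (p i).hom ≫ j i = 𝟙 A.X := by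
    refine joint _ _ fun k => ?_
    rw [Preadditive.sum_comp, Finset.sum_eq_single k]
    · rw [Category.assoc, jp1, Category.comp_id, Category.id_comp]
    · intro i _ h
      rw [Category.assoc, jp0 i k h, comp_zero]
    · simp
  have fac : ∀ i, IsDirectFactor (p i) (j i) := fun i => by
    refine ⟨jp1 i, joint _ _ fun k => ?_, joint _ _ fun k => ?_⟩
    · rw [Category.assoc, IsMonHom.mul_hom, Category.assoc, Category.assoc,
        MonoidalCategory.tensorHom_def', Category.assoc,
        ← MonoidalCategory.whiskerLeft_comp_assoc]
      by_cases h : i = k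
      · subst h; simp [jp1]
      · simp [jp0 i k h]
    · rw [Category.assoc, IsMonHom.mul_hom, Category.assoc, Category.assoc,
        MonoidalCategory.tensorHom_def, Category.assoc, ← comp_whiskerRight_assoc]
      by_cases h : i = k
      · subst h; simp [jp1]
      · simp [jp0 i k h]
  choose s hs using fun i => (isSeparable_iff (B i)).1 (hB i)
  refine (isSeparable_iff A).2 ⟨∑ i, (p i).hom ≫ s i ≫ (j i ⊗ₘ j i), ?_, ?_, ?_⟩
  · rw [← sum, Preadditive.sum_comp]
    refine Finset.sum_congr rfl fun i _ => ?_
    rw [Category.assoc, Category.assoc, (fac i).mul, reassoc_of% (hs i).comp_mul]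
  · rw [whiskerLeft_sum, Preadditive.sum_comp, Preadditive.comp_sum]
    exact Finset.sum_congr rfl fun i _ => ((fac i).left_section (hs i)).symm
  · rw [sum_whiskerRight, Preadditive.sum_comp, Preadditive.comp_sum]
    exact Finset.sum_congr rfl fun i _ => ((fac i).right_section (hs i)).symm

end DirectSum

/-! ### Modules over a separable algebra form a semisimple category -/

namespace RMod

section Free

variable {C : Type u} [Category.{v} C] [MonoidalCategory C] {A : Mon C}

/-- The map of modules `c ⊗ A ⟶ M` induced by a morphism `c ⟶ M`. -/
@[simps]
def freeLift {c : C} {M : RMod A} (g : c ⟶ M.X) : tensorObj c (regular A) ⟶ M where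
  hom := g ▷ A.X ≫ M.act
  act_hom := by
    change ((α_ c A.X A.X).hom ≫ c ◁ μ) ≫ g ▷ A.X ≫ M.act = (g ▷ A.X ≫ M.act) ▷ A.X ≫ M.act
    rw [Category.assoc, whisker_exchange_assoc, M.act_assoc]
    simp

/-- Whiskering of a module by a morphism. -/
@[simps]
def whisker {c c' : C} (f : c ⟶ c') (M : RMod A) : tensorObj c M ⟶ tensorObj c' M where
  hom := f ▷ M.X
  act_hom := by
    dsimp only [tensorObj]
    rw [Category.assoc, whisker_exchange, ← associator_naturality_left_assoc]

/-- Every module is a retract of a free one. The action map has the unit as a section in `C`, which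
cancels the first factor in `f ≫ g ≫ f = f` and leaves `g ≫ f = 𝟙`. -/
lemma exists_section_act (reg : IsVonNeumannRegular (RMod A)) (M : RMod A) :
    ∃ r : M ⟶ tensorObj M.X (regular A), r ≫ freeLift (𝟙 M.X) = 𝟙 M := by
  obtain ⟨r, hr⟩ := reg (freeLift (𝟙 M.X))
  refine ⟨r, ?_⟩
  ext
  have h1 : (𝟙 M.X ▷ A.X ≫ M.act) ≫ r.hom ≫ (𝟙 M.X ▷ A.X ≫ M.act) = 𝟙 M.X ▷ A.X ≫ M.act :=
    congrArg Hom.hom hr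
  have h2 : ((ρ_ M.X).inv ≫ M.X ◁ η) ≫ 𝟙 M.X ▷ A.X ≫ M.act = 𝟙 M.X := by
    simp [M.act_one]
  have h3 := congrArg (fun t => ((ρ_ M.X).inv ≫ M.X ◁ η) ≫ t) h1
  rw [← Category.assoc, h2, Category.id_comp] at h3
  exact h3

-- The image in `C` of a module idempotent inherits an action: include, act, project.
variable (A) in
lemma isIdempotentComplete [IsIdempotentComplete C] : IsIdempotentComplete (RMod A) where
  idempotents_split M e he := by
    obtain ⟨Y, i, p, hip, hpi⟩ := IsIdempotentComplete.idempotents_split M.X e.hom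
      (congrArg Hom.hom he)
    have h1 : (i ▷ A.X ≫ M.act ≫ p) ≫ i = i ▷ A.X ≫ M.act := by
      simp only [Category.assoc]
      rw [hpi, e.act_hom, ← comp_whiskerRight_assoc, ← hpi, reassoc_of% hip]
    have h2 : p ▷ A.X ≫ (i ▷ A.X ≫ M.act ≫ p) = M.act ≫ p := by
      rw [← comp_whiskerRight_assoc, hpi, ← Category.assoc, ← e.act_hom, Category.assoc, ← hpi,
        Category.assoc, hip, Category.comp_id]
    let N : RMod A :=
      { X := Y
        act := i ▷ A.X ≫ M.act ≫ p
        act_one := by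
          rw [whisker_exchange_assoc, ← Category.assoc (M.X ◁ η), M.act_one,
            rightUnitor_naturality_assoc, hip, Category.comp_id]
        act_assoc := by
          rw [comp_whiskerRight_assoc, comp_whiskerRight_assoc, h2, whisker_exchange_assoc,
            ← Category.assoc (M.X ◁ μ), M.act_assoc]
          simp }
    exact ⟨N, ⟨i, h1⟩, ⟨p, h2.symm⟩, by ext; exact hip, by ext; exact hpi⟩

end Free

section Semisimple

attribute [local instance] Abelian.hasFiniteBiproducts

variable {k : Type w} [Field k] {C : Type u} [Category.{v} C] [Abelian C] [Linear k C]
    [MonoidalCategory C] [MonoidalPreadditive C] [MonoidalLinear k C] {A : Mon C}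

lemma finite_hom (h : ∀ X Y : C, Module.Finite k (X ⟶ Y)) (M N : RMod A) :
    Module.Finite k (M ⟶ N) := by
  have := h M.X N.X
  let Φ : (M ⟶ N) →ₗ[k] (M.X ⟶ N.X) :=
    { toFun := fun f => f.hom
      map_add' := fun _ _ => rfl
      map_smul' := fun _ _ => rfl }
  exact Module.Finite.of_injective Φ (hom_injective M N)

/-- `M` is a retract of `M ⊗ A`, and `M` as an object of `C` is a retract of a finite sum of copies
of `G`. -/
lemma isFiniteGenerator (reg : IsVonNeumannRegular (RMod A)) {G : C} (gen : IsFiniteGenerator G) :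
    IsFiniteGenerator (tensorObj G (regular A)) := by
  intro M
  obtain ⟨r, hr⟩ := exists_section_act reg M
  obtain ⟨n, a, b, hab⟩ := gen M.X
  refine ⟨n, fun i => whisker (a i) _ ≫ freeLift (𝟙 M.X), fun i => r ≫ whisker (b i) _, ?_⟩
  have : ∑ i, whisker (b i) (regular A) ≫ whisker (a i) (regular A) = 𝟙 _ := by
    apply hom_injective
    have h : ∀ i, (whisker (b i) (regular A) ≫ whisker (a i) (regular A)).hom =
      (b i ≫ a i) ▷ A.X := fun i => (comp_whiskerRight _ _ _).symm
    refine (map_sum (homAddMonoidHom (tensorObj M.X (regular A)) (tensorObj M.X (regular A)))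
      _ _).trans ?_
    refine (Finset.sum_congr rfl fun i _ => h i).trans ?_
    refine (sum_whiskerRight _ _ _).symm.trans ?_
    rw [hab]
    exact id_whiskerRight _ _
  simp only [Category.assoc]
  rw [← Preadditive.comp_sum]
  simp only [← Category.assoc (whisker _ _)]
  rw [← Preadditive.sum_comp, this, Category.id_comp, hr]

/-- The right modules over a separable algebra form a semisimple category. -/
lemma isSemisimpleCategory (hC : IsSemisimpleCategory k C) (hA : IsSeparable A) :
    IsSemisimpleCategory k (RMod A) := by
  have reg := isVonNeumannRegular hC.isVonNeumannRegular hA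
  obtain ⟨G, gen⟩ := hC.exists_isFiniteGenerator
  have := isIdempotentComplete A
  have := fun X => finite_hom (A := A) hC.finite_hom (tensorObj G (regular A)) X
  refine isSemisimpleCategory_of_isFiniteGenerator _ (isFiniteGenerator reg gen)
    (fun f => reg f) fun n => ?_
  refine ⟨tensorObj (⨁ fun _ : Fin n => G) (regular A),
    fun i => whisker (biproduct.ι (fun _ : Fin n => G) i) _,
    fun i => whisker (biproduct.π (fun _ : Fin n => G) i) _, fun a b => ?_⟩
  apply hom_injective
  have : (whisker (biproduct.ι (fun _ : Fin n => G) a) (regular A) ≫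
      whisker (biproduct.π (fun _ : Fin n => G) b) (regular A)).hom =
      (biproduct.ι (fun _ : Fin n => G) a ≫ biproduct.π (fun _ : Fin n => G) b) ▷ A.X :=
    (comp_whiskerRight _ _ _).symm
  refine this.trans ?_
  split_ifs with h
  · subst h
    rw [biproduct.ι_π_self]
    exact id_whiskerRight _ _
  · rw [biproduct.ι_π_ne _ h]
    exact MonoidalPreadditive.zero_whiskerRight

/-- The modules over a division algebra are indecomposable. -/
lemma isIndecomposableModule (reg : IsVonNeumannRegular (RMod A)) (hA : IsDivisionAlgebra A) :
    IsIndecomposableModule C (RMod A) := by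
  have hA : Simple (regular A) := hA
  refine ⟨⟨regular A, Simple.not_isZero _⟩, fun P Q h => ?_⟩
  -- A summand containing `A` contains all free modules. A module receiving only zero maps from free
  -- modules is zero, being a retract of one of them.
  have key : ∀ (P : ObjectProperty (RMod A)), (∀ (c : C) (x : RMod A), P x → P (c ⊙ₗ x)) →
      P (regular A) → ∀ Q : ObjectProperty (RMod A),
      (∀ (x y : RMod A) (f : x ⟶ y), P x → Q y → f = 0) → ∀ z, Q z → IsZero z := by
    intro P hP hr Q hPQ z hz
    obtain ⟨r, hr'⟩ := exists_section_act reg z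
    have h0 := hPQ _ _ (freeLift (𝟙 z.X)) (hP z.X _ hr) hz
    rw [IsZero.iff_id_eq_zero, ← hr', h0, comp_zero]
  -- Decompose `A` itself. One of its two summand inclusions is nonzero, hence an isomorphism by
  -- simplicity, so `A` lies in one of the two parts.
  obtain ⟨x, y, b, hx, hy, ⟨hb⟩, ⟨e⟩⟩ := h.exists_sum (regular A)
  have hP := h.iso_left
  have hQ := h.iso_right
  have m1 : Mono (b.inl ≫ e.inv) := by
    have : IsSplitMono b.inl := ⟨⟨⟨b.fst, b.inl_fst⟩⟩⟩
    infer_instance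
  have m2 : Mono (b.inr ≫ e.inv) := by
    have : IsSplitMono b.inr := ⟨⟨⟨b.snd, b.inr_snd⟩⟩⟩
    infer_instance
  by_cases h1 : b.inl ≫ e.inv = 0
  · by_cases h2 : b.inr ≫ e.inv = 0
    · exfalso
      apply Simple.not_isZero (regular A)
      rw [IsZero.iff_id_eq_zero, ← e.hom_inv_id, ← Category.id_comp e.inv]
      have : 𝟙 b.pt = b.fst ≫ b.inl + b.snd ≫ b.inr := (IsBilimit.binary_total hb).symm
      rw [this, Preadditive.add_comp, Category.assoc, Category.assoc, h1, h2]
      simp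
    · left
      have := (Simple.mono_isIso_iff_nonzero (b.inr ≫ e.inv)).2 h2
      exact key Q h.act_right (hQ.of_iso (asIso (b.inr ≫ e.inv)) hy) P
        fun x y f hx hy => h.hom_right_left y x f hy hx
  · right
    have := (Simple.mono_isIso_iff_nonzero (b.inl ≫ e.inv)).2 h1
    exact key P h.act_left (hP.of_iso (asIso (b.inl ≫ e.inv)) hx) Q h.hom_left_right

end Semisimple

end RMod

lemma isSimpleAlgebra_of_isDivisionAlgebra {k : Type w} [Field k] {C : Type u} [Category.{v} C]
    [Abelian C] [Linear k C] [MonoidalCategory C] [MonoidalPreadditive C] [MonoidalLinear k C]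
    {A : Mon C} (hC : IsSemisimpleCategory k C) (hs : IsSeparable A) (hd : IsDivisionAlgebra A) :
    IsSimpleAlgebra k A :=
  ⟨RMod.isSemisimpleCategory hC hs,
    RMod.isIndecomposableModule (RMod.isVonNeumannRegular hC.isVonNeumannRegular hs) hd⟩

end MultiFusion

end

noncomputable section

namespace MultiFusion

/-! ### Morita invariance of separability -/

section Projective

variable {C : Type u} [Category.{v} C] [MonoidalCategory C]

/-- The map of bimodules `A ⊗ A ⟶ N`, `a ⊗ b ↦ a t b`, for an element `t` of `N`. -/
def bimodOfElement {A : Mon C} (N : Bimod A A) (t : 𝟙_ C ⟶ N.X) : tensorSquare A ⟶ N where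
  hom := ((ρ_ A.X).inv ≫ A.X ◁ t ≫ N.actLeft) ▷ A.X ≫ N.actRight
  left_act_hom := by
    dsimp only [tensorSquare]
    have h : μ ≫ (ρ_ A.X).inv ≫ A.X ◁ t ≫ N.actLeft =
        A.X ◁ ((ρ_ A.X).inv ≫ A.X ◁ t ≫ N.actLeft) ≫ N.actLeft := by
      rw [rightUnitor_inv_naturality_assoc, ← whisker_exchange_assoc, N.left_assoc]
      monoidal
    rw [Category.assoc, ← comp_whiskerRight_assoc, h, comp_whiskerRight_assoc, N.middle_assoc,
      ← whisker_assoc_symm_assoc, MonoidalCategory.whiskerLeft_comp_assoc]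
  right_act_hom := by
    dsimp only [tensorSquare]
    rw [Category.assoc, whisker_exchange_assoc, N.right_assoc,
      associator_inv_naturality_left_assoc, Iso.hom_inv_id_assoc, comp_whiskerRight_assoc]

lemma bimodOfElement_comp {A : Mon C} {N : Bimod A A} (t : 𝟙_ C ⟶ N.X)
    (f : N ⟶ Bimod.regular A) (ht : t ≫ f.hom = η[A.X]) : bimodOfElement N t ≫ f = mulBimod A := by
  ext
  change (((ρ_ A.X).inv ≫ A.X ◁ t ≫ N.actLeft) ▷ A.X ≫ N.actRight) ≫ f.hom = μ
  rw [Category.assoc, f.right_act_hom, ← comp_whiskerRight_assoc, Category.assoc, Category.assoc,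
    f.left_act_hom, ← MonoidalCategory.whiskerLeft_comp_assoc, ht]
  change ((ρ_ A.X).inv ≫ A.X ◁ η ≫ μ) ▷ A.X ≫ μ = μ
  simp

/-- Relative projectivity of `A`. A splitting in `C` provides an element of `N` over the unit, this
element defines a bimodule map `A ⊗ A ⟶ N` lifting the multiplication, and precomposing with the
bimodule section gives a section of `f`. -/
lemma IsSeparable.isSplitEpi {A : Mon C} (hC : IsVonNeumannRegular C) (hA : IsSeparable A)
    {N : Bimod A A} (f : N ⟶ Bimod.regular A) [Epi f.hom] : IsSplitEpi f := by
  obtain ⟨⟨s, hs⟩⟩ := hA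
  obtain ⟨⟨g, hg⟩⟩ := hC.isSplitEpi f.hom
  refine ⟨⟨⟨s ≫ bimodOfElement N (η[A.X] ≫ g), ?_⟩⟩⟩
  rw [Category.assoc, bimodOfElement_comp, hs]
  exact (Category.assoc _ _ _).trans ((congrArg _ hg).trans (Category.comp_id _))

end Projective

/-! ### Invertible 1-cells reflect split epimorphisms -/

section Bicategory

open Bicategory

/-- Whiskering the section by `Q` splits `Q ◁ P ◁ f`, which is identified with `f` through `Q ≫ P ≅
𝟙`. -/
lemma isSplitEpi_of_whiskerLeft {B : Type*} [Bicategory B] {a b c : B} (P : a ⟶ b) (Q : b ⟶ a)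
    (e : Q ≫ P ≅ 𝟙 b) {M N : b ⟶ c} (f : M ⟶ N) (h : IsSplitEpi (P ◁ f)) : IsSplitEpi f := by
  obtain ⟨⟨s, hs⟩⟩ := h
  refine ⟨⟨⟨(Bicategory.leftUnitor N).inv ≫ e.inv ▷ N ≫ (α_ Q P N).hom ≫ Q ◁ s ≫ (α_ Q P M).inv ≫
    e.hom ▷ M ≫
    (Bicategory.leftUnitor M).hom, ?_⟩⟩⟩
  have h1 : Q ◁ s ≫ Q ◁ P ◁ f = 𝟙 _ := by rw [← Bicategory.whiskerLeft_comp, hs]; simp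
  have h2 : (α_ Q P M).inv ≫ e.hom ▷ M ≫ (Bicategory.leftUnitor M).hom ≫ f =
    Q ◁ P ◁ f ≫ (α_ Q P N).inv ≫ e.hom ▷ N ≫ (Bicategory.leftUnitor N).hom := by
    rw [← Bicategory.leftUnitor_naturality, ← Bicategory.whisker_exchange_assoc]
    simp
  simp only [Category.assoc]
  rw [h2, reassoc_of% h1]
  simp

lemma isSplitEpi_of_whiskerRight {B : Type*} [Bicategory B] {a b c : B} (P : a ⟶ b) (Q : b ⟶ a)
    (e : P ≫ Q ≅ 𝟙 a) {M N : c ⟶ a} (f : M ⟶ N) (h : IsSplitEpi (f ▷ P)) : IsSplitEpi f := by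
  obtain ⟨⟨s, hs⟩⟩ := h
  refine ⟨⟨⟨(Bicategory.rightUnitor N).inv ≫ N ◁ e.inv ≫ (α_ N P Q).inv ≫ s ▷ Q ≫ (α_ M P Q).hom ≫
    M ◁ e.hom ≫
    (Bicategory.rightUnitor M).hom, ?_⟩⟩⟩
  have h1 : s ▷ Q ≫ f ▷ P ▷ Q = 𝟙 _ := by rw [← Bicategory.comp_whiskerRight, hs]; simp
  have h2 : (α_ M P Q).hom ≫ M ◁ e.hom ≫ (Bicategory.rightUnitor M).hom ≫ f =
    f ▷ P ▷ Q ≫ (α_ N P Q).hom ≫ N ◁ e.hom ≫ (Bicategory.rightUnitor N).hom := by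
    rw [← Bicategory.rightUnitor_naturality, Bicategory.whisker_exchange_assoc]
    simp
  simp only [Category.assoc]
  rw [h2, reassoc_of% h1]
  simp

end Bicategory

/-! ### Transfer of separability along an invertible bimodule -/

section Morita

variable {C : Type u} [Category.{v} C] [Abelian C] [MonoidalCategory C] [RigidCategory C]

/-- In a rigid category tensoring preserves epimorphisms, and the relative tensor product is a
quotient of the tensor product. -/
lemma epi_whiskerLeft_hom {X Y Z : Mon C} (P : Bimod X Y) {M N : Bimod Y Z} (f : M ⟶ N)
    [Epi f.hom] : Epi (Bimod.whiskerLeft P f).hom := by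
  have h : tensorProj P M ≫ (Bimod.whiskerLeft P f).hom = P.X ◁ f.hom ≫ tensorProj P N :=
    ι_colimMap _ _
  have : Epi (P.X ◁ f.hom) := inferInstanceAs (Epi ((tensorLeft P.X).map f.hom))
  have : Epi (tensorProj P N) := inferInstanceAs (Epi (coequalizer.π _ _))
  have : Epi (tensorProj P M ≫ (Bimod.whiskerLeft P f).hom) := by rw [h]; infer_instance
  exact epi_of_epi (tensorProj P M) _

lemma epi_whiskerRight_hom {X Y Z : Mon C} {M N : Bimod X Y} (f : M ⟶ N) (P : Bimod Y Z)
    [Epi f.hom] : Epi (Bimod.whiskerRight f P).hom := by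
  have h : tensorProj M P ≫ (Bimod.whiskerRight f P).hom = f.hom ▷ P.X ≫ tensorProj N P :=
    ι_colimMap _ _
  have : Epi (f.hom ▷ P.X) := inferInstanceAs (Epi ((tensorRight P.X).map f.hom))
  have : Epi (tensorProj N P) := inferInstanceAs (Epi (coequalizer.π _ _))
  have : Epi (tensorProj M P ≫ (Bimod.whiskerRight f P).hom) := by rw [h]; infer_instance
  exact epi_of_epi (tensorProj M P) _

/-- Tensoring the multiplication of `B` with `P` and `Q` gives an epimorphism onto `P ⊗_B B ⊗_B Q ≅
A`. It splits by relative projectivity of `A`. The isomorphism `Q ⊗_A P ≅ B` then removes `P` and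
`Q` one after the other. -/
lemma IsSeparable.of_isInvertibleBimod {A B : Mon C} (hC : IsVonNeumannRegular C) (P : Bimod A B)
    (hP : IsInvertibleBimod P) (hA : IsSeparable A) : IsSeparable B := by
  obtain ⟨Q, ⟨e₁⟩, ⟨e₂⟩⟩ := hP
  let F := Bimod.whiskerLeft P (Bimod.whiskerRight (mulBimod B) Q)
  have : IsSplitEpi (mulBimod B).hom := ⟨⟨⟨(ρ_ B.X).inv ≫ B.X ◁ η, by
    change ((ρ_ B.X).inv ≫ B.X ◁ η) ≫ μ = 𝟙 B.X
    rw [Category.assoc, MonObj.mul_one, Iso.inv_hom_id]⟩⟩⟩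
  have := epi_whiskerRight_hom (mulBimod B) Q
  have hF : Epi F.hom := epi_whiskerLeft_hom P _
  let e : P.tensorBimod ((Bimod.regular B).tensorBimod Q) ≅ Bimod.regular A :=
    ⟨Bimod.whiskerLeft P (Bimod.leftUnitorBimod Q).hom,
      Bimod.whiskerLeft P (Bimod.leftUnitorBimod Q).inv, by
        rw [← Bimod.whiskerLeft_comp_bimod, Iso.hom_inv_id, Bimod.whiskerLeft_id_bimod], by
        rw [← Bimod.whiskerLeft_comp_bimod, Iso.inv_hom_id, Bimod.whiskerLeft_id_bimod]⟩ ≪≫ e₁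
  have he : IsIso e.hom.hom := ⟨e.inv.hom, congrArg Bimod.Hom.hom e.hom_inv_id,
    congrArg Bimod.Hom.hom e.inv_hom_id⟩
  have : Epi (F ≫ e.hom).hom := epi_comp F.hom e.hom.hom
  obtain ⟨⟨s, hs⟩⟩ := IsSeparable.isSplitEpi hC hA (F ≫ e.hom)
  have hFs : IsSplitEpi F := ⟨⟨⟨e.hom ≫ s, by
    rw [← cancel_mono e.hom, Category.assoc, Category.assoc, hs]; simp⟩⟩⟩
  let := Bimod.monBicategory (C := C)
  have h1 : IsSplitEpi (Bimod.whiskerRight (mulBimod B) Q) :=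
    isSplitEpi_of_whiskerLeft (B := Mon C) (a := A) (b := B) (c := A) P Q e₂ _ hFs
  exact isSplitEpi_of_whiskerRight (B := Mon C) (a := B) (b := A) (c := B) Q P e₂ _ h1

lemma IsInvertibleBimod.exists_symm {A B : Mon C} {P : Bimod A B} (hP : IsInvertibleBimod P) :
    ∃ Q : Bimod B A, IsInvertibleBimod Q := by
  obtain ⟨Q, e₁, e₂⟩ := hP
  exact ⟨Q, P, e₂, e₁⟩

/-- Separability is Morita invariant. -/
lemma MoritaEquivalent.isSeparable_iff {A B : Mon C} (hC : IsVonNeumannRegular C)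
    (h : MoritaEquivalent A B) : IsSeparable A ↔ IsSeparable B := by
  obtain ⟨P, hP⟩ := h
  obtain ⟨Q, hQ⟩ := hP.exists_symm
  exact ⟨.of_isInvertibleBimod hC P hP, .of_isInvertibleBimod hC Q hQ⟩

end Morita

end MultiFusion

end

noncomputable section

namespace MultiFusion

/-! ### Idempotents of an algebra and their corner bimodules -/

/-- An idempotent of the algebra `A`, given by the operators `L` of left multiplication and `R` of
right multiplication. -/
@[ext]
structure AlgIdempotent {C : Type u} [Category.{v} C] [MonoidalCategory C] (A : Mon C) where
  L : A.X ⟶ A.X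
  R : A.X ⟶ A.X
  mul_L : μ ≫ L = L ▷ A.X ≫ μ
  mul_R : μ ≫ R = A.X ◁ R ≫ μ
  balanced : R ▷ A.X ≫ μ = A.X ◁ L ≫ μ
  L_L : L ≫ L = L
  R_R : R ≫ R = R
  unit : η ≫ L = η ≫ R

attribute [simp] AlgIdempotent.L_L AlgIdempotent.R_R

namespace AlgIdempotent

section Basic

variable {C : Type u} [Category.{v} C] [MonoidalCategory C] {A : Mon C}

instance : IsSplitEpi (μ[A.X]) := ⟨⟨⟨(ρ_ A.X).inv ≫ A.X ◁ η, by simp⟩⟩⟩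

/-- Left and right multiplications visibly commute on a product, and the multiplication of `A` is a
split epimorphism. -/
lemma comm (i j : AlgIdempotent A) : i.L ≫ j.R = j.R ≫ i.L := by
  rw [← cancel_epi μ[A.X], reassoc_of% i.mul_L, j.mul_R, reassoc_of% j.mul_R, i.mul_L,
    whisker_exchange_assoc]

variable (A) in
/-- The unit of an algebra, as an idempotent. -/
@[simps]
protected def one : AlgIdempotent A where
  L := 𝟙 _
  R := 𝟙 _
  mul_L := by simp
  mul_R := by simp
  balanced := by simp
  L_L := by simp
  R_R := by simp
  unit := rfl

lemma rightMul_mul (e : A.X ⟶ A.X) : μ ≫ (ρ_ A.X).inv ≫ A.X ◁ (η ≫ e) ≫ μ =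
    A.X ◁ ((ρ_ A.X).inv ≫ A.X ◁ (η ≫ e) ≫ μ) ≫ μ := by
  rw [rightUnitor_inv_naturality_assoc, ← whisker_exchange_assoc, MonObj.mul_assoc]
  monoidal

lemma unit_rightMul (e : A.X ⟶ A.X) : η ≫ (ρ_ A.X).inv ≫ A.X ◁ (η ≫ e) ≫ μ = η ≫ e := by
  rw [rightUnitor_inv_naturality_assoc, ← whisker_exchange_assoc, MonObj.one_mul,
    leftUnitor_naturality, unitors_equal, Iso.inv_hom_id_assoc]

/-- The idempotent of a map of right modules `e : A ⟶ A`. -/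
@[simps L]
def ofLeft (e : A.X ⟶ A.X) (h : μ ≫ e = e ▷ A.X ≫ μ) (he : e ≫ e = e) : AlgIdempotent A where
  L := e
  R := (ρ_ A.X).inv ≫ A.X ◁ (η ≫ e) ≫ μ
  mul_L := h
  mul_R := rightMul_mul e
  balanced := by
    have h1 : (A.X ◁ (η ≫ e)) ▷ A.X ≫ (α_ _ _ _).hom ≫ A.X ◁ μ =
        (A.X ◁ η) ▷ A.X ≫ (α_ _ _ _).hom ≫ A.X ◁ (μ ≫ e) := by
      rw [h]
      simp
    rw [comp_whiskerRight_assoc, comp_whiskerRight_assoc, MonObj.mul_assoc,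
      reassoc_of% h1, MonoidalCategory.whiskerLeft_comp_assoc, associator_naturality_middle_assoc,
      ← MonoidalCategory.whiskerLeft_comp_assoc _ (η ▷ A.X), MonObj.one_mul]
    monoidal
  L_L := he
  R_R := by
    -- The element `e(1)` is idempotent: `e(1) e(1) = e(e(1)) = e(1)`, because the left-hand
    -- multiplication `e` commutes with right multiplications.
    have h2 : (η ≫ e) ≫ (ρ_ A.X).inv ≫ A.X ◁ (η ≫ e) ≫ μ = η ≫ e := by
      have h3 : ∀ f : A.X ⟶ A.X, μ ≫ f = A.X ◁ f ≫ μ → e ≫ f = f ≫ e := fun f hf => by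
        rw [← cancel_epi μ[A.X], reassoc_of% h, hf, reassoc_of% hf, h, whisker_exchange_assoc]
      rw [Category.assoc, h3 _ (rightMul_mul e), ← Category.assoc, unit_rightMul,
        Category.assoc, he]
    rw [Category.assoc, Category.assoc, rightMul_mul, ← MonoidalCategory.whiskerLeft_comp_assoc, h2]
  unit := (unit_rightMul e).symm

end Basic

/-! ### Corners, their multiplication, and the bimodules they form -/

section Corner

variable {C : Type u} [Category.{v} C] [MonoidalCategory C] [IsIdempotentComplete C] {A : Mon C}
  (i j l m : AlgIdempotent A)

lemma exists_splitting : ∃ (Y : C) (incl : Y ⟶ A.X) (proj : A.X ⟶ Y),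
    incl ≫ proj = 𝟙 Y ∧ proj ≫ incl = i.L ≫ j.R :=
  IsIdempotentComplete.idempotents_split A.X (i.L ≫ j.R) (by
    rw [Category.assoc, ← reassoc_of% comm, reassoc_of% L_L, R_R])

/-- The corner `e_i A e_j`. -/
def corner : C := (exists_splitting i j).choose

/-- The inclusion of the corner `e_i A e_j`. -/
def incl : corner i j ⟶ A.X := (exists_splitting i j).choose_spec.choose

/-- The projection to the corner `e_i A e_j`. -/
def proj : A.X ⟶ corner i j := (exists_splitting i j).choose_spec.choose_spec.choose

@[simp]
lemma incl_proj : incl i j ≫ proj i j = 𝟙 _ :=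
  (exists_splitting i j).choose_spec.choose_spec.choose_spec.1

lemma proj_incl : proj i j ≫ incl i j = i.L ≫ j.R :=
  (exists_splitting i j).choose_spec.choose_spec.choose_spec.2

instance : IsSplitMono (incl i j) := ⟨⟨⟨proj i j, incl_proj i j⟩⟩⟩

@[simp]
lemma incl_L : incl i j ≫ i.L = incl i j := by
  have h : incl i j ≫ i.L ≫ j.R = incl i j := by rw [← proj_incl, reassoc_of% incl_proj]
  rw [← h, Category.assoc, Category.assoc, ← comm, reassoc_of% L_L]

@[simp]
lemma incl_R : incl i j ≫ j.R = incl i j := by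
  have h : incl i j ≫ i.L ≫ j.R = incl i j := by rw [← proj_incl, reassoc_of% incl_proj]
  rw [← h, Category.assoc, Category.assoc, R_R]

@[simp]
lemma L_proj : i.L ≫ proj i j = proj i j := by
  rw [← cancel_mono (incl i j), Category.assoc, proj_incl, reassoc_of% L_L]

@[simp]
lemma R_proj : j.R ≫ proj i j = proj i j := by
  rw [← cancel_mono (incl i j), Category.assoc, proj_incl, comm, reassoc_of% R_R]

/-- The multiplication `e_i A e_j ⊗ e_j A e_l ⟶ e_i A e_l`. -/
def comp : corner i j ⊗ corner j l ⟶ corner i l := (incl i j ⊗ₘ incl j l) ≫ μ ≫ proj i l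

@[simp]
lemma comp_incl : comp i j l ≫ incl i l = (incl i j ⊗ₘ incl j l) ≫ μ := by
  rw [comp, Category.assoc, Category.assoc, proj_incl, reassoc_of% mul_L, mul_R, ← tensorHom_id,
    ← id_tensorHom, tensorHom_comp_tensorHom_assoc, tensorHom_comp_tensorHom_assoc, incl_L,
    Category.comp_id, Category.comp_id, incl_R]

/-- The unit of `e_i A e_i`. -/
def cornerOne : 𝟙_ C ⟶ corner i i := η[A.X] ≫ proj i i

@[simp]
lemma cornerOne_incl : cornerOne i ≫ incl i i = η[A.X] ≫ i.L := by
  rw [cornerOne, Category.assoc, proj_incl, ← Category.assoc, i.unit, Category.assoc, R_R]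

lemma cornerOne_comp : cornerOne i ▷ corner i j ≫ comp i i j = (λ_ _).hom := by
  rw [← cancel_mono (incl i j), Category.assoc, comp_incl, MonoidalCategory.tensorHom_def,
    Category.assoc, ← comp_whiskerRight_assoc, cornerOne_incl, comp_whiskerRight_assoc,
    ← whisker_exchange_assoc, ← mul_L, ← whisker_exchange_assoc, MonObj.one_mul_assoc,
    leftUnitor_naturality_assoc, incl_L]

lemma comp_cornerOne : corner i j ◁ cornerOne j ≫ comp i j j = (ρ_ _).hom := by
  rw [← cancel_mono (incl i j), Category.assoc, comp_incl, MonoidalCategory.tensorHom_def',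
    Category.assoc, ← MonoidalCategory.whiskerLeft_comp_assoc, cornerOne_incl, j.unit,
    MonoidalCategory.whiskerLeft_comp_assoc,
    whisker_exchange_assoc, ← mul_R, whisker_exchange_assoc, MonObj.mul_one_assoc,
    rightUnitor_naturality_assoc, incl_R]

lemma comp_assoc : comp i j l ▷ corner l m ≫ comp i l m =
    (α_ _ _ _).hom ≫ corner i j ◁ comp j l m ≫ comp i j m := by
  rw [← cancel_mono (incl i m)]
  simp only [Category.assoc, comp_incl]
  rw [← tensorHom_id, ← id_tensorHom, tensorHom_comp_tensorHom_assoc,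
    tensorHom_comp_tensorHom_assoc, comp_incl, comp_incl, Category.id_comp, Category.id_comp,
    ← Category.comp_id (incl l m), ← Category.comp_id (incl i j), ← tensorHom_comp_tensorHom_assoc,
    ← tensorHom_comp_tensorHom_assoc, tensorHom_id, id_tensorHom, MonObj.mul_assoc,
    associator_naturality_assoc]
  simp only [Category.comp_id]

/-- The algebra `e_i A e_i`. -/
@[simps X]
def diag : Mon C where
  X := corner i i
  mon :=
    { one := cornerOne i
      mul := comp i i i
      one_mul := cornerOne_comp i i
      mul_one := comp_cornerOne i i
      mul_assoc := comp_assoc i i i i }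

/-- The bimodule `e_i A e_j`. -/
@[simps X actLeft actRight]
def entry : Bimod (diag i) (diag j) where
  X := corner i j
  actLeft := comp i i j
  actRight := comp i j j
  one_actLeft := cornerOne_comp i j
  left_assoc := comp_assoc i i i j
  actRight_one := comp_cornerOne i j
  right_assoc := by
    change corner i j ◁ comp j j j ≫ comp i j j =
      (α_ _ _ _).inv ≫ comp i j j ▷ corner j j ≫ comp i j j
    rw [comp_assoc, Iso.inv_hom_id_assoc]
  middle_assoc := comp_assoc i i j j

/-- The idempotent `e_i` is of the form `∑ x e_j y`. -/
def IsGeneratedBy : Prop := ∃ u : 𝟙_ C ⟶ A.X ⊗ A.X, u ≫ j.R ▷ A.X ≫ μ = η ≫ i.L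

end Corner

end AlgIdempotent

end MultiFusion

end

noncomputable section

namespace MultiFusion

/-! ### Relative tensor products of corner bimodules -/

section TensorBimod

variable {C : Type u} [Category.{v} C] [Abelian C] [MonoidalCategory C] [RigidCategory C]
  {X Y Z : Mon C} (P : Bimod X Y) (Q : Bimod Y Z)

instance : Epi (tensorProj P Q) := inferInstanceAs (Epi (coequalizer.π _ _))

lemma tensorProj_condition : P.actRight ▷ Q.X ≫ tensorProj P Q =
    (α_ _ _ _).hom ≫ P.X ◁ Q.actLeft ≫ tensorProj P Q :=
  (coequalizer.condition _ _).trans (Category.assoc _ _ _)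

/-- The morphism out of a relative tensor product induced by a balanced morphism. -/
def tensorDesc {W : C} (h : P.X ⊗ Q.X ⟶ W)
    (w : P.actRight ▷ Q.X ≫ h = (α_ _ _ _).hom ≫ P.X ◁ Q.actLeft ≫ h) :
    (P.tensorBimod Q).X ⟶ W :=
  coequalizer.desc h (w.trans (Category.assoc _ _ _).symm)

@[simp]
lemma tensorProj_tensorDesc {W : C} (h : P.X ⊗ Q.X ⟶ W)
    (w : P.actRight ▷ Q.X ≫ h = (α_ _ _ _).hom ≫ P.X ◁ Q.actLeft ≫ h) :
    tensorProj P Q ≫ tensorDesc P Q h w = h :=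
  coequalizer.π_desc _ _

lemma whiskerLeft_tensorProj_actLeft : X.X ◁ tensorProj P Q ≫ (P.tensorBimod Q).actLeft =
    (α_ _ _ _).inv ≫ P.actLeft ▷ Q.X ≫ tensorProj P Q :=
  Bimod.TensorBimod.whiskerLeft_π_actLeft P Q

lemma tensorProj_whiskerRight_actRight : tensorProj P Q ▷ Z.X ≫ (P.tensorBimod Q).actRight =
    (α_ _ _ _).hom ≫ P.X ◁ Q.actRight ≫ tensorProj P Q :=
  Bimod.TensorBimod.π_tensor_id_actRight P Q

instance (V : C) : Epi (V ◁ tensorProj P Q) :=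
  inferInstanceAs (Epi ((tensorLeft V).map (tensorProj P Q)))

instance (V : C) : Epi (tensorProj P Q ▷ V) :=
  inferInstanceAs (Epi ((tensorRight V).map (tensorProj P Q)))

end TensorBimod

namespace AlgIdempotent

section Generated

variable {C : Type u} [Category.{v} C] [MonoidalCategory C] {A : Mon C}
  {i j l : AlgIdempotent A}

lemma isGeneratedBy_refl (i : AlgIdempotent A) : IsGeneratedBy i i :=
  ⟨(λ_ _).inv ≫ (η ⊗ₘ η), by
    rw [MonoidalCategory.tensorHom_def, Category.assoc, Category.assoc, whisker_exchange_assoc,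
      MonObj.mul_one, ← comp_whiskerRight_assoc, rightUnitor_naturality, ← unitors_equal,
      Iso.inv_hom_id_assoc, i.unit]⟩

/-- Substitute `e_j = ∑ x' e_l y'` into `e_i = ∑ x e_j y`; the new witness is `∑ x x' ⊗ y' y`. -/
lemma IsGeneratedBy.trans (h : IsGeneratedBy i j) (h' : IsGeneratedBy j l) :
    IsGeneratedBy i l := by
  obtain ⟨u, hu⟩ := h
  obtain ⟨v, hv⟩ := h'
  -- Right multiplication by `e_j`, computed through its expression `∑ x' e_l y'`.
  have h1 : (ρ_ A.X).inv ≫ A.X ◁ v ≫ (α_ A.X A.X A.X).inv ≫ μ ▷ A.X ≫ l.R ▷ A.X ≫ μ = j.R := by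
    rw [← comp_whiskerRight_assoc, mul_R, comp_whiskerRight_assoc, MonObj.mul_assoc,
      associator_naturality_middle_assoc, Iso.inv_hom_id_assoc,
      ← MonoidalCategory.whiskerLeft_comp_assoc, ← MonoidalCategory.whiskerLeft_comp_assoc,
      Category.assoc, hv, MonoidalCategory.whiskerLeft_comp_assoc, ← balanced,
      whisker_exchange_assoc, MonObj.mul_one, rightUnitor_naturality, Iso.inv_hom_id_assoc]
  refine ⟨u ≫ ((ρ_ A.X).inv ≫ A.X ◁ v ≫ (α_ A.X A.X A.X).inv ≫ μ ▷ A.X) ▷ A.X ≫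
    (α_ A.X A.X A.X).hom ≫ A.X ◁ μ, ?_⟩
  rw [← hu, ← h1]
  simp only [Category.assoc, comp_whiskerRight]
  rw [MonObj.mul_assoc, associator_naturality_left_assoc, whisker_exchange_assoc]
  simp only [associator_naturality_left_assoc]

lemma IsGeneratedBy.mono_right (h : IsGeneratedBy i j) (hR : j.R ≫ l.R = j.R) :
    IsGeneratedBy i l := by
  obtain ⟨u, hu⟩ := h
  refine ⟨u ≫ j.R ▷ A.X, ?_⟩
  rw [Category.assoc, ← comp_whiskerRight_assoc, hR, hu]

/-- Cutting the witness down by `e_i` and `e_j` moves it into the corners: `e_i = ∑ (e_i x e_j)(e_j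
y e_i)`. -/
lemma IsGeneratedBy.exists_unit [IsIdempotentComplete C] (h : IsGeneratedBy i j) :
    ∃ u : 𝟙_ C ⟶ corner i j ⊗ corner j i, u ≫ comp i j i = cornerOne i := by
  obtain ⟨u, hu⟩ := h
  refine ⟨u ≫ (proj i j ⊗ₘ proj j i), ?_⟩
  rw [← cancel_mono (incl i i), Category.assoc, Category.assoc, comp_incl,
    tensorHom_comp_tensorHom_assoc, proj_incl, proj_incl, cornerOne_incl,
    MonoidalCategory.tensorHom_def, MonoidalCategory.whiskerLeft_comp, Category.assoc,
    Category.assoc, ← mul_R, ← reassoc_of% balanced, comp_whiskerRight_assoc,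
    ← comp_whiskerRight_assoc j.R, R_R, ← comp_whiskerRight_assoc, comm, comp_whiskerRight_assoc,
    ← reassoc_of% mul_L, reassoc_of% hu, reassoc_of% L_L, ← Category.assoc, i.unit,
    Category.assoc, R_R]

end Generated

section Tensor

variable {C : Type u} [Category.{v} C] [Abelian C] [MonoidalCategory C] [RigidCategory C]
  {A : Mon C} (i j l : AlgIdempotent A)

/-- The relative tensor product of `e_i A e_j` and `e_j A e_l`. -/
def relTensor : C := ((entry i j).tensorBimod (entry j l)).X

/-- The projection to the relative tensor product. -/
def relProj : corner i j ⊗ corner j l ⟶ relTensor i j l := tensorProj (entry i j) (entry j l)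

instance : Epi (relProj i j l) := inferInstanceAs (Epi (tensorProj _ _))

instance (V : C) : Epi (V ◁ relProj i j l) := inferInstanceAs (Epi (V ◁ tensorProj _ _))

instance (V : C) : Epi (relProj i j l ▷ V) := inferInstanceAs (Epi (tensorProj _ _ ▷ V))

lemma relProj_condition : comp i j j ▷ corner j l ≫ relProj i j l =
    (α_ _ _ _).hom ≫ corner i j ◁ comp j j l ≫ relProj i j l :=
  tensorProj_condition (entry i j) (entry j l)

/-- The map `e_i A e_j ⊗ e_j A e_l ⟶ e_i A e_l` on the relative tensor product. -/
def relComp : relTensor i j l ⟶ corner i l :=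
  tensorDesc (entry i j) (entry j l) (comp i j l) (comp_assoc i j j l)

@[simp]
lemma relProj_relComp : relProj i j l ≫ relComp i j l = comp i j l :=
  tensorProj_tensorDesc (entry i j) (entry j l) (comp i j l) (comp_assoc i j j l)

/-- The left action of `e_i A e_i` on the relative tensor product. -/
def relActLeft : corner i i ⊗ relTensor i j l ⟶ relTensor i j l :=
  ((entry i j).tensorBimod (entry j l)).actLeft

/-- The right action of `e_l A e_l` on the relative tensor product. -/
def relActRight : relTensor i j l ⊗ corner l l ⟶ relTensor i j l :=
  ((entry i j).tensorBimod (entry j l)).actRight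

lemma actLeft_relComp : relActLeft i j l ≫ relComp i j l =
    corner i i ◁ relComp i j l ≫ comp i i l := by
  have h : corner i i ◁ relProj i j l ≫ relActLeft i j l =
    (α_ _ _ _).inv ≫ comp i i j ▷ corner j l ≫ relProj i j l :=
      whiskerLeft_tensorProj_actLeft (entry i j) (entry j l)
  rw [← cancel_epi (corner i i ◁ relProj i j l), ← MonoidalCategory.whiskerLeft_comp_assoc,
    relProj_relComp]
  rw [reassoc_of% h, relProj_relComp, comp_assoc, Iso.inv_hom_id_assoc]

lemma actRight_relComp : relActRight i j l ≫ relComp i j l =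
    relComp i j l ▷ corner l l ≫ comp i l l := by
  have h : relProj i j l ▷ corner l l ≫ relActRight i j l =
    (α_ _ _ _).hom ≫ corner i j ◁ comp j l l ≫ relProj i j l :=
      tensorProj_whiskerRight_actRight (entry i j) (entry j l)
  rw [← cancel_epi (relProj i j l ▷ corner l l), ← comp_whiskerRight_assoc,
    relProj_relComp]
  rw [reassoc_of% h, relProj_relComp, comp_assoc]

variable {i j}

/-- With `e_i = ∑ x y`, where `x ∈ e_i A e_j` and `y ∈ e_j A e_i`, the inverse is `z ↦ ∑ x ⊗ y z`.
On a product, `x ⊗ y (a b) = x (y a) ⊗ b` by balancing, which sums to `a ⊗ b`; the other composite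
is `∑ x (y z) = z`. -/
lemma IsGeneratedBy.isIso_relComp (h : IsGeneratedBy i j) : IsIso (relComp i j l) := by
  obtain ⟨u, hu⟩ := h.exists_unit
  refine ⟨(λ_ _).inv ≫ u ▷ corner i l ≫ (α_ _ _ _).hom ≫ corner i j ◁ comp j i l ≫
    relProj i j l, ?_, ?_⟩
  · rw [← cancel_epi (relProj i j l), reassoc_of% relProj_relComp, Category.comp_id,
      leftUnitor_inv_naturality_assoc, whisker_exchange_assoc, associator_naturality_right_assoc,
      ← MonoidalCategory.whiskerLeft_comp_assoc]
    have h1 : corner j i ◁ comp i j l ≫ comp j i l =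
        (α_ _ _ _).inv ≫ comp j i j ▷ corner j l ≫ comp j j l := by
      rw [comp_assoc, Iso.inv_hom_id_assoc]
    have h2 : corner i j ◁ comp j j l ≫ relProj i j l =
        (α_ _ _ _).inv ≫ comp i j j ▷ corner j l ≫ relProj i j l := by
      rw [relProj_condition, Iso.inv_hom_id_assoc]
    have h3 : corner i j ◁ comp j i j ≫ comp i j j =
        (α_ _ _ _).inv ≫ comp i j i ▷ corner i j ≫ comp i i j := by
      rw [comp_assoc, Iso.inv_hom_id_assoc]
    rw [h1, MonoidalCategory.whiskerLeft_comp_assoc, MonoidalCategory.whiskerLeft_comp_assoc, h2,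
      associator_inv_naturality_middle_assoc, ← comp_whiskerRight_assoc (corner i j ◁ comp j i j),
      h3]
    have h4 : (λ_ _).inv ≫ (u ≫ comp i j i) ▷ corner i j ≫ comp i i j = 𝟙 _ := by
      rw [hu, cornerOne_comp, Iso.inv_hom_id]
    have h5 := congrArg (fun t => t ▷ corner j l ≫ relProj i j l) h4
    beta_reduce at h5
    rw [id_whiskerRight, Category.id_comp] at h5
    refine Eq.trans ?_ h5
    monoidal
  · simp only [Category.assoc]
    rw [relProj_relComp, ← comp_assoc, ← comp_whiskerRight_assoc, hu, cornerOne_comp,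
      Iso.inv_hom_id]

/-- The isomorphism `e_i A e_j ⊗ e_j A e_l ≅ e_i A e_l` of bimodules. -/
def IsGeneratedBy.tensorIso (h : IsGeneratedBy i j) :
    (entry i j).tensorBimod (entry j l) ≅ entry i l :=
  have := h.isIso_relComp l
  let e : relTensor i j l ≅ corner i l := asIso (relComp i j l)
  Bimod.isoOfIso e (actLeft_relComp i j l) (actRight_relComp i j l)

lemma IsGeneratedBy.tensorProj_tensorIso (h : IsGeneratedBy i j) :
    tensorProj (entry i j) (entry j l) ≫ (h.tensorIso l).hom.hom = comp i j l :=
  relProj_relComp i j l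

lemma isInvertibleBimod_entry (h : IsGeneratedBy i j) (h' : IsGeneratedBy j i) :
    IsInvertibleBimod (entry i j) :=
  ⟨entry j i, ⟨h.tensorIso i⟩, ⟨h'.tensorIso j⟩⟩

end Tensor

end AlgIdempotent

end MultiFusion

end

noncomputable section

namespace MultiFusion

namespace AlgIdempotent

/-! ### Minimal idempotents and division algebras -/

section Minimal

variable {C : Type u} [Category.{v} C] [MonoidalCategory C] {A : Mon C} {i j : AlgIdempotent A}

lemma L_eq (i : AlgIdempotent A) : i.L = (λ_ A.X).inv ≫ (η ≫ i.L) ▷ A.X ≫ μ := by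
  rw [comp_whiskerRight_assoc, ← i.mul_L, MonObj.one_mul_assoc, Iso.inv_hom_id_assoc]

lemma R_eq (i : AlgIdempotent A) : i.R = (ρ_ A.X).inv ≫ A.X ◁ (η ≫ i.L) ≫ μ := by
  rw [i.unit, MonoidalCategory.whiskerLeft_comp_assoc, ← i.mul_R, MonObj.mul_one_assoc,
    Iso.inv_hom_id_assoc]

variable [Abelian C]

/-- An idempotent `e` is minimal if it is nonzero and every nonzero subobject of `e A` generates
the right ideal `e A`. -/
structure IsMinimal (i : AlgIdempotent A) : Prop where
  ne_zero : i.L ≠ 0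
  exists_lift : ∀ ⦃c : C⦄ (g : c ⟶ A.X), g ≠ 0 → g ≫ i.L = g →
    ∃ y : 𝟙_ C ⟶ c ⊗ A.X, y ≫ g ▷ A.X ≫ μ = η ≫ i.L

/-- `e_i A e_j` is a nonzero part of `e_i A`, hence generates it as a right ideal. In particular
`e_i` is a sum of products `(e_i z e_j) y`. -/
lemma IsMinimal.isGeneratedBy (hi : IsMinimal i) (h : i.L ≫ j.R ≠ 0) : IsGeneratedBy i j := by
  obtain ⟨y, hy⟩ := hi.exists_lift (i.L ≫ j.R) h (by rw [Category.assoc, ← comm, reassoc_of% L_L])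
  exact ⟨y ≫ i.L ▷ A.X, by rw [Category.assoc, ← comp_whiskerRight_assoc, hy]⟩

variable [MonoidalPreadditive C]

lemma unit_L_ne_zero (h : i.L ≠ 0) : η ≫ i.L ≠ 0 := fun h0 => h (by rw [L_eq, h0]; simp)

/-- A morphism `c ⟶ e A` of `C` extends to a module map `c ⊗ A ⟶ e A`, which is nonzero because it
restricts to `g` along the unit. Minimality among modules gives a lift `A ⟶ c ⊗ A`, and its value at
the unit is the required element. -/
lemma isMinimal_ofLeft {e : A.X ⟶ A.X} (h : μ ≫ e = e ▷ A.X ≫ μ) (h' : e ≫ e = e)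
    (he : IsMinimalIdempotent (A := RMod.regular A) (RMod.Hom.mk e h)) :
    IsMinimal (ofLeft e h h') where
  ne_zero h0 := he.ne_zero (RMod.hom_ext _ _ h0)
  exists_lift c g hg hgL := by
    have h1 : RMod.freeLift (M := RMod.regular A) g ≠ 0 := fun h0 => by
      have h2 : g ▷ A.X ≫ μ = 0 := congrArg RMod.Hom.hom h0
      apply hg
      have h3 : g = (ρ_ c).inv ≫ c ◁ η ≫ g ▷ A.X ≫ μ := by
        rw [whisker_exchange_assoc, MonObj.mul_one]
        simp
      rw [h3, h2]
      simp
    obtain ⟨t, ht⟩ := he.exists_lift (RMod.freeLift (M := RMod.regular A) g) h1 (by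
      ext
      change (g ▷ A.X ≫ μ) ≫ e = g ▷ A.X ≫ μ
      rw [Category.assoc, h, ← comp_whiskerRight_assoc]
      exact congrArg (fun t => t ▷ A.X ≫ μ) hgL)
    have ht' : t.hom ≫ g ▷ A.X ≫ μ = e := congrArg RMod.Hom.hom ht
    refine ⟨η[A.X] ≫ t.hom, ?_⟩
    exact (Category.assoc _ _ _).trans (congrArg (η[A.X] ≫ ·) ht')

/-- A nonzero submodule `Y` of `e A e` generates `e A` as a right ideal of `A`. Cutting the
generating expression down by `e` produces an element of `Y` lying over the unit `e`, so the
inclusion of `Y` is also a split epimorphism. -/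
lemma IsMinimal.isDivisionAlgebra_diag (hi : IsMinimal i) : IsDivisionAlgebra (diag i) := by
  refine ⟨fun {Y} f _ => ⟨fun hf h0 => ?_, fun hf => ?_⟩⟩
  · subst h0
    have h1 : 𝟙 (RMod.regular (diag i)) = 0 := by
      rw [← IsIso.inv_hom_id (0 : Y ⟶ RMod.regular (diag i)), comp_zero]
    have h2 : 𝟙 (corner i i) = 0 := congrArg RMod.Hom.hom h1
    apply unit_L_ne_zero hi.ne_zero
    rw [← cornerOne_incl, ← Category.id_comp (incl i i), h2, zero_comp, comp_zero]
  · let F : Y.X ⟶ corner i i := f.hom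
    let act : Y.X ⊗ corner i i ⟶ Y.X := Y.act
    have act_assoc : Y.X ◁ comp i i i ≫ act = (α_ _ _ _).inv ≫ act ▷ corner i i ≫ act := Y.act_assoc
    have act_F : act ≫ F = F ▷ corner i i ≫ comp i i i := f.act_hom
    obtain ⟨y, hy⟩ := hi.exists_lift (F ≫ incl i i)
      (fun h0 => hf (RMod.hom_ext _ _ (zero_of_comp_mono (f := F) (incl i i) h0))) (by simp)
    -- From `∑ y₁ y₂ = e` with `y₁` in `Y`, the element `z = ∑ y₁ (e y₂ e)` lies in `Y` and maps to
    -- `e`.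
    let z : 𝟙_ C ⟶ Y.X := y ≫ Y.X ◁ proj i i ≫ act
    have hz : z ≫ F = cornerOne i := by
      have h1 : (F ≫ incl i i) ▷ A.X ≫ A.X ◁ (i.L ≫ i.R) ≫ μ = (F ≫ incl i i) ▷ A.X ≫ μ ≫ i.R := by
        rw [MonoidalCategory.whiskerLeft_comp_assoc, ← mul_R, ← reassoc_of% i.balanced,
          ← comp_whiskerRight_assoc, Category.assoc, incl_R]
      rw [← cancel_mono (incl i i), cornerOne_incl, i.unit, ← i.R_R, ← Category.assoc η,
        ← i.unit, ← hy]
      simp only [z, Category.assoc]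
      rw [reassoc_of% act_F, comp_incl, MonoidalCategory.tensorHom_def_assoc,
        ← comp_whiskerRight_assoc, whisker_exchange_assoc,
        ← MonoidalCategory.whiskerLeft_comp_assoc, proj_incl, h1]
    let r : RMod.regular (diag i) ⟶ Y :=
      ⟨(λ_ (corner i i)).inv ≫ z ▷ corner i i ≫ act, by
        change comp i i i ≫ (λ_ (corner i i)).inv ≫ z ▷ corner i i ≫ act =
          ((λ_ (corner i i)).inv ≫ z ▷ corner i i ≫ act) ▷ corner i i ≫ act
        rw [leftUnitor_inv_naturality_assoc, whisker_exchange_assoc, act_assoc]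
        monoidal⟩
    have hr : r ≫ f = 𝟙 _ := by
      ext
      change ((λ_ (corner i i)).inv ≫ z ▷ corner i i ≫ act) ≫ F = 𝟙 (corner i i)
      rw [Category.assoc, Category.assoc, act_F, ← comp_whiskerRight_assoc, hz, cornerOne_comp,
        Iso.inv_hom_id]
    have : IsSplitEpi f := ⟨⟨⟨r, hr⟩⟩⟩
    exact isIso_of_mono_of_isSplitEpi f

/-- `e_i = e_i e_i = ∑ x (e_j y e_i)` would vanish along with `e_j A e_i`. -/
lemma IsGeneratedBy.right_ne_zero (h : IsGeneratedBy i j) (hi : i.L ≠ 0) : j.L ≫ i.R ≠ 0 := by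
  intro h0
  obtain ⟨u, hu⟩ := h
  apply unit_L_ne_zero hi
  rw [i.unit, ← i.R_R, ← Category.assoc, ← i.unit, ← hu, Category.assoc, Category.assoc, mul_R,
    ← whisker_exchange_assoc, balanced, ← MonoidalCategory.whiskerLeft_comp_assoc, ← comm,
    h0]
  simp

lemma IsMinimal.isGeneratedBy_symm (hi : IsMinimal i) (hj : IsMinimal j) (h : IsGeneratedBy i j) :
    IsGeneratedBy j i :=
  hj.isGeneratedBy (h.right_ne_zero hi.ne_zero)

end Minimal

end AlgIdempotent

end MultiFusion

end

noncomputable section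

namespace MultiFusion

namespace AlgIdempotent

/-! ### Central idempotents and direct factors -/

section Central

variable {C : Type u} [Category.{v} C] [MonoidalCategory C] [IsIdempotentComplete C] {A : Mon C}

/-- The projection to the direct factor of a central idempotent. -/
def factorProj (e : AlgIdempotent A) (he : e.L = e.R) : A ⟶ diag e where
  hom := proj e e
  isMonHom_hom :=
    { one_hom := rfl
      mul_hom := by
        change μ ≫ proj e e = (proj e e ⊗ₘ proj e e) ≫ comp e e e
        rw [← cancel_mono (incl e e), Category.assoc, Category.assoc, comp_incl, proj_incl,
          tensorHom_comp_tensorHom_assoc, proj_incl, ← he, L_L, MonoidalCategory.tensorHom_def,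
          Category.assoc, ← e.balanced, ← he, ← comp_whiskerRight_assoc, L_L, mul_L] }

lemma isDirectFactor_factorProj (e : AlgIdempotent A) (he : e.L = e.R) :
    IsDirectFactor (factorProj e he) (incl e e) where
  comp := incl_proj e e
  left := by
    change A.X ◁ incl e e ≫ μ = proj e e ▷ corner e e ≫ comp e e e ≫ incl e e
    rw [comp_incl, MonoidalCategory.tensorHom_def_assoc, ← comp_whiskerRight_assoc, proj_incl, he,
      R_R, ← whisker_exchange_assoc, e.balanced, ← MonoidalCategory.whiskerLeft_comp_assoc, incl_L]
  right := by
    change incl e e ▷ A.X ≫ μ = corner e e ◁ proj e e ≫ comp e e e ≫ incl e e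
    rw [comp_incl, MonoidalCategory.tensorHom_def'_assoc,
      ← MonoidalCategory.whiskerLeft_comp_assoc, proj_incl, ← he, L_L, whisker_exchange_assoc,
      ← e.balanced, ← comp_whiskerRight_assoc, incl_R]

end Central

/-! ### Sums of orthogonal idempotents -/

section Sum

variable {C : Type u} [Category.{v} C] [Abelian C] [MonoidalCategory C] [MonoidalPreadditive C]
  {A : Mon C} {J : Type} [Fintype J] {i : J → AlgIdempotent A}

/-- Both conditions say that the product `e_i e_j` is zero; the order of composition is opposite for
left and right multiplications. -/
lemma R_comp_R_eq_zero {i j : AlgIdempotent A} (h : j.L ≫ i.L = 0) : i.R ≫ j.R = 0 := by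
  have h1 : i.R ≫ j.R = (ρ_ A.X).inv ≫ A.X ◁ (η ≫ i.R ≫ j.R) ≫ μ := by
    rw [MonoidalCategory.whiskerLeft_comp_assoc, MonoidalCategory.whiskerLeft_comp_assoc,
      ← j.mul_R, ← reassoc_of% i.mul_R, MonObj.mul_one_assoc, Iso.inv_hom_id_assoc]
  have h2 : η ≫ i.R ≫ j.R = 0 := by
    rw [← Category.assoc, ← i.unit, Category.assoc, comm, ← Category.assoc, ← j.unit,
      Category.assoc, h, comp_zero]
  rw [h1, h2]
  simp

variable (i) in
/-- The sum of orthogonal idempotents. -/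
@[simps]
def sum (h : ∀ a b, a ≠ b → (i a).L ≫ (i b).L = 0) : AlgIdempotent A where
  L := ∑ a, (i a).L
  R := ∑ a, (i a).R
  mul_L := by
    rw [Preadditive.comp_sum, sum_whiskerRight, Preadditive.sum_comp]
    exact Finset.sum_congr rfl fun a _ => (i a).mul_L
  mul_R := by
    rw [Preadditive.comp_sum, whiskerLeft_sum, Preadditive.sum_comp]
    exact Finset.sum_congr rfl fun a _ => (i a).mul_R
  balanced := by
    rw [sum_whiskerRight, whiskerLeft_sum, Preadditive.sum_comp, Preadditive.sum_comp]
    exact Finset.sum_congr rfl fun a _ => (i a).balanced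
  L_L := by
    rw [Preadditive.sum_comp]
    refine Finset.sum_congr rfl fun a _ => ?_
    rw [Preadditive.comp_sum, Finset.sum_eq_single a (fun b _ hb => h a b hb.symm) (by simp), L_L]
  R_R := by
    rw [Preadditive.sum_comp]
    refine Finset.sum_congr rfl fun a _ => ?_
    rw [Preadditive.comp_sum, Finset.sum_eq_single a
      (fun b _ hb => R_comp_R_eq_zero (h b a hb)) (by simp), R_R]
  unit := by
    rw [Preadditive.comp_sum, Preadditive.comp_sum]
    exact Finset.sum_congr rfl fun a _ => (i a).unit

lemma sum_R_eq_id (h : ∑ a, (i a).L = 𝟙 A.X) : ∑ a, (i a).R = 𝟙 A.X := by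
  have : ∑ a, (i a).R = (ρ_ A.X).inv ≫ A.X ◁ (η ≫ ∑ a, (i a).L) ≫ μ := by
    rw [Preadditive.comp_sum, whiskerLeft_sum, Preadditive.sum_comp, Preadditive.comp_sum]
    exact Finset.sum_congr rfl fun a _ => R_eq _
  rw [this, h, Category.comp_id, MonObj.mul_one, Iso.inv_hom_id]

variable (h : ∀ a b, a ≠ b → (i a).L ≫ (i b).L = 0)

lemma L_sum_L (a : J) : (i a).L ≫ (sum i h).L = (i a).L := by
  rw [sum_L, Preadditive.comp_sum, Finset.sum_eq_single a (fun b _ hb => h a b hb.symm) (by simp),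
    L_L]

lemma R_sum_R (a : J) : (i a).R ≫ (sum i h).R = (i a).R := by
  rw [sum_R, Preadditive.comp_sum, Finset.sum_eq_single a
    (fun b _ hb => R_comp_R_eq_zero (h b a hb)) (by simp), R_R]

lemma isGeneratedBy_sum_left {j : AlgIdempotent A} (hj : ∀ a, IsGeneratedBy (i a) j) :
    IsGeneratedBy (sum i h) j := by
  choose u hu using hj
  refine ⟨∑ a, u a, ?_⟩
  rw [Preadditive.sum_comp, sum_L, Preadditive.comp_sum]
  exact Finset.sum_congr rfl fun a _ => hu a

lemma isGeneratedBy_sum_right (a : J) : IsGeneratedBy (i a) (sum i h) :=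
  (isGeneratedBy_refl _).mono_right (R_sum_R h a)

/-- A sum of idempotents is central if it is orthogonal to the complementary sum. -/
lemma sum_subtype_central (hs : ∑ a, (i a).L = 𝟙 A.X) (p : J → Prop) [DecidablePred p]
    (hp : ∀ a b, p a → ¬ p b → (i a).L ≫ (i b).R = 0 ∧ (i b).L ≫ (i a).R = 0) :
    ∑ a : {a // p a}, (i a).L = ∑ a : {a // p a}, (i a).R := by
  -- With `e` the partial sum, the right multiplications outside `p` contribute nothing on `e A`, so
  -- `e A = e A e`. The next identity gives `A e = e A e` in the same way.
  have h1 : ∑ a : {a // p a}, (i a).L =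
      (∑ a : {a // p a}, (i a).L) ≫ ∑ b : {b // p b}, (i b).R := by
    conv_lhs => rw [← Category.comp_id (∑ a : {a // p a}, (i a).L), ← sum_R_eq_id hs,
      ← Fintype.sum_subtype_add_sum_subtype p, Preadditive.comp_add]
    convert add_zero _
    rw [Preadditive.sum_comp]
    refine Finset.sum_eq_zero fun a _ => ?_
    rw [Preadditive.comp_sum]
    exact Finset.sum_eq_zero fun b _ => (hp a b a.2 b.2).1
  have h2 : ∑ b : {b // p b}, (i b).R =
      (∑ a : {a // p a}, (i a).L) ≫ ∑ b : {b // p b}, (i b).R := by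
    conv_lhs => rw [← Category.id_comp (∑ b : {b // p b}, (i b).R), ← hs,
      ← Fintype.sum_subtype_add_sum_subtype p, Preadditive.add_comp]
    convert add_zero _
    rw [Preadditive.sum_comp]
    refine Finset.sum_eq_zero fun a _ => ?_
    rw [Preadditive.comp_sum]
    exact Finset.sum_eq_zero fun b _ => (hp b a b.2 a.2).2
  rw [h1, ← h2]

end Sum

end AlgIdempotent

section DirectSum

attribute [local instance] Abelian.hasFiniteBiproducts

variable {C : Type u} [Category.{v} C] [Abelian C] [MonoidalCategory C] {A : Mon C}

open AlgIdempotent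

/-- A decomposition of the unit into orthogonal central idempotents decomposes the algebra. -/
lemma isDirectSum_of_central {m : ℕ} (e : Fin m → AlgIdempotent A)
    (central : ∀ a, (e a).L = (e a).R) (orth : ∀ a b, a ≠ b → (e a).L ≫ (e b).L = 0)
    (hs : ∑ a, (e a).L = 𝟙 A.X) : IsDirectSum A fun a => diag (e a) := by
  refine ⟨fun a => factorProj (e a) (central a), ?_⟩
  let F : A.X ⟶ ⨁ fun a => corner (e a) (e a) := biproduct.lift fun a => proj (e a) (e a)
  let G : (⨁ fun a => corner (e a) (e a)) ⟶ A.X := biproduct.desc fun a => incl (e a) (e a)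
  refine (?_ : IsIso F)
  refine ⟨G, ?_, ?_⟩
  · rw [biproduct.lift_desc, ← hs]
    refine Finset.sum_congr rfl fun a _ => ?_
    rw [proj_incl, ← central, L_L]
  · refine biproduct.hom_ext' _ _ fun a => biproduct.hom_ext _ _ fun b => ?_
    rw [biproduct.ι_desc_assoc, Category.assoc, biproduct.lift_π, Category.comp_id]
    by_cases hab : a = b
    · subst hab
      rw [incl_proj, biproduct.ι_π_self]
    · rw [biproduct.ι_π_ne _ hab, ← L_proj, ← incl_L (e a) (e a), Category.assoc,
        ← Category.assoc (e a).L, orth a b hab, zero_comp, comp_zero]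

end DirectSum

end MultiFusion

end

noncomputable section

namespace MultiFusion

open AlgIdempotent

/-! ### Separable algebras are direct sums of matrix algebras -/

section Matrix

attribute [local instance] Abelian.hasFiniteBiproducts

variable {k : Type w} [Field k] {C : Type u} [Category.{v} C] [Abelian C] [Linear k C]
    [MonoidalCategory C] [MonoidalPreadditive C] [MonoidalLinear k C] {A : Mon C}

lemma incl_proj_incl_sum {n : ℕ} (i : Fin (n + 1) → AlgIdempotent A)
    (h : ∀ a b, a ≠ b → (i a).L ≫ (i b).L = 0) (a b : Fin (n + 1)) :
    (incl (i a) (i b) ≫ proj (AlgIdempotent.sum i h) (AlgIdempotent.sum i h)) ≫ incl _ _ =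
      incl (i a) (i b) := by
  rw [Category.assoc, proj_incl, ← incl_L, Category.assoc, ← Category.assoc (i a).L, L_sum_L,
    reassoc_of% incl_L, ← incl_R, Category.assoc, R_sum_R, incl_R, incl_L]

/-- The decomposition of `e A e` for a sum `e` of orthogonal idempotents. -/
def cornerDecomp {n : ℕ} (i : Fin (n + 1) → AlgIdempotent A)
    (h : ∀ a b, a ≠ b → (i a).L ≫ (i b).L = 0) :
    corner (AlgIdempotent.sum i h) (AlgIdempotent.sum i h) ≅
      ⨁ fun p : Fin (n + 1) × Fin (n + 1) => corner (i p.1) (i p.2) where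
  hom := biproduct.lift fun p => incl _ _ ≫ proj (i p.1) (i p.2)
  inv := biproduct.desc fun p => incl (i p.1) (i p.2) ≫ proj _ _
  hom_inv_id := by
    rw [biproduct.lift_desc]
    have : ∀ p : Fin (n + 1) × Fin (n + 1),
        (incl (AlgIdempotent.sum i h) (AlgIdempotent.sum i h) ≫ proj (i p.1) (i p.2)) ≫
          incl (i p.1) (i p.2) ≫ proj (AlgIdempotent.sum i h) (AlgIdempotent.sum i h) =
        incl _ _ ≫ ((i p.1).L ≫ (i p.2).R) ≫ proj _ _ := fun p => by
      rw [← proj_incl]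
      simp only [Category.assoc]
    rw [Finset.sum_congr rfl fun p _ => this p, ← Preadditive.comp_sum, ← Preadditive.sum_comp,
      Fintype.sum_prod_type]
    simp only [← Preadditive.comp_sum, ← Preadditive.sum_comp]
    have h1 : (∑ a, (i a).L) ≫ ∑ a, (i a).R =
      (AlgIdempotent.sum i h).L ≫ (AlgIdempotent.sum i h).R := rfl
    rw [h1, Category.assoc, R_proj, L_proj, incl_proj]
  inv_hom_id := by
    refine biproduct.hom_ext' _ _ fun p => biproduct.hom_ext _ _ fun q => ?_
    rw [biproduct.ι_desc_assoc, Category.assoc, biproduct.lift_π, Category.comp_id]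
    have h0 : (incl (i p.1) (i p.2) ≫ proj (AlgIdempotent.sum i h) (AlgIdempotent.sum i h)) ≫
        incl (AlgIdempotent.sum i h) (AlgIdempotent.sum i h) ≫ proj (i q.1) (i q.2) =
        incl (i p.1) (i p.2) ≫ proj (i q.1) (i q.2) := by
      rw [← Category.assoc, incl_proj_incl_sum]
    rw [h0]
    by_cases hpq : p = q
    · subst hpq
      rw [incl_proj, biproduct.ι_π_self]
    · rw [biproduct.ι_π_ne _ hpq]
      by_cases h1 : p.1 = q.1
      · have h2 : p.2 ≠ q.2 := fun h2 => hpq (Prod.ext h1 h2)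
        rw [← incl_R, ← R_proj, Category.assoc, ← Category.assoc (i p.2).R,
          R_comp_R_eq_zero (h _ _ h2.symm), zero_comp, comp_zero]
      · rw [← incl_L, ← L_proj, Category.assoc, ← Category.assoc (i p.1).L, h _ _ h1, zero_comp,
          comp_zero]

lemma biproduct_ι_cornerDecomp_inv {n : ℕ} (i : Fin (n + 1) → AlgIdempotent A)
    (h : ∀ a b, a ≠ b → (i a).L ≫ (i b).L = 0) (a b : Fin (n + 1)) :
    biproduct.ι (fun p : Fin (n + 1) × Fin (n + 1) => corner (i p.1) (i p.2)) (a, b) ≫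
      (cornerDecomp i h).inv = incl (i a) (i b) ≫ proj _ _ :=
  biproduct.ι_desc _ _

lemma tensorHom_comp_sum {n : ℕ} (i : Fin (n + 1) → AlgIdempotent A)
    (h : ∀ a b, a ≠ b → (i a).L ≫ (i b).L = 0) (a b c d : Fin (n + 1)) :
    ((incl (i a) (i b) ≫ proj (AlgIdempotent.sum i h) (AlgIdempotent.sum i h)) ⊗ₘ
      (incl (i c) (i d) ≫ proj (AlgIdempotent.sum i h) (AlgIdempotent.sum i h))) ≫ comp _ _ _ =
        (incl (i a) (i b) ⊗ₘ incl (i c) (i d)) ≫ μ ≫ proj _ _ := by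
  rw [comp, tensorHom_comp_tensorHom_assoc, incl_proj_incl_sum, incl_proj_incl_sum]

variable [RigidCategory C]

/-- The matrix algebra of a finite family of orthogonal equivalent idempotents. -/
def matrixDecomposition {n : ℕ} (i : Fin (n + 1) → AlgIdempotent A)
    (h : ∀ a b, a ≠ b → (i a).L ≫ (i b).L = 0) (hg : ∀ a b, IsGeneratedBy (i a) (i b))
    (hd : ∀ a, IsDivisionAlgebra (diag (i a))) (hs : ∀ a, IsSimpleAlgebra k (diag (i a))) :
    MatrixDecomposition k (diag (AlgIdempotent.sum i h)) where
  n := n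
  diag a := diag (i a)
  diag_simple := hs
  diag_division := hd
  entry a b := entry (i a) (i b)
  entry_self a := Iso.refl _
  entry_invertible a b := isInvertibleBimod_entry (hg a b) (hg b a)
  compIso a b c := (hg a b).tensorIso (i c)
  decomp := cornerDecomp i h
  mul_comp a b c := by
    have h1 : tensorProj (entry (i a) (i b)) (entry (i b) (i c)) ≫
      ((hg a b).tensorIso (i c)).hom.hom = comp (i a) (i b) (i c) :=
        (hg a b).tensorProj_tensorIso (i c)
    rw [← Category.assoc (tensorProj _ _), h1]
    change ((biproduct.ι (fun p : Fin (n + 1) × Fin (n + 1) => corner (i p.1) (i p.2)) (a, b) ≫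
      (cornerDecomp i h).inv) ⊗ₘ (biproduct.ι (fun p : Fin (n + 1) × Fin (n + 1) =>
        corner (i p.1) (i p.2)) (b, c) ≫ (cornerDecomp i h).inv)) ≫ comp _ _ _ =
      comp _ _ _ ≫ (biproduct.ι (fun p : Fin (n + 1) × Fin (n + 1) =>
        corner (i p.1) (i p.2)) (a, c) ≫ (cornerDecomp i h).inv)
    rw [biproduct_ι_cornerDecomp_inv, biproduct_ι_cornerDecomp_inv, biproduct_ι_cornerDecomp_inv,
      tensorHom_comp_sum, reassoc_of% comp_incl]
  mul_zero a b b' c hb := by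
    change ((biproduct.ι (fun p : Fin (n + 1) × Fin (n + 1) => corner (i p.1) (i p.2)) (a, b) ≫
      (cornerDecomp i h).inv) ⊗ₘ (biproduct.ι (fun p : Fin (n + 1) × Fin (n + 1) =>
        corner (i p.1) (i p.2)) (b', c) ≫ (cornerDecomp i h).inv)) ≫ comp _ _ _ = 0
    rw [biproduct_ι_cornerDecomp_inv, biproduct_ι_cornerDecomp_inv, tensorHom_comp_sum]
    have h1 : (incl (i a) (i b) ⊗ₘ incl (i b') (i c)) ≫ μ = 0 := by
      rw [← incl_R (i a) (i b), ← incl_L (i b') (i c), ← tensorHom_comp_tensorHom, Category.assoc,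
        MonoidalCategory.tensorHom_def (i b).R, Category.assoc,  ← whisker_exchange_assoc,
        (i b).balanced, ← MonoidalCategory.whiskerLeft_comp_assoc, h _ _ hb.symm]
      simp
    rw [← Category.assoc, h1, zero_comp]

/-- A separable algebra is a direct sum of separable matrix algebras. -/
theorem IsSeparable.exists_isDirectSum (hC : IsSemisimpleCategory k C) (hA : IsSeparable A) :
    ∃ (m : ℕ) (B : Fin m → Mon C),
      (∀ i, IsMatrixAlgebra k (B i) ∧ IsSeparable (B i)) ∧ IsDirectSum A B := by
  classical
  have regC := hC.isVonNeumannRegular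
  have := RMod.finite_hom (A := A) hC.finite_hom (RMod.regular A) (RMod.regular A)
  obtain ⟨J, _, f, f_min, f_orth, f_sum⟩ := exists_minimal_decomposition k
    (RMod.isVonNeumannRegular regC hA) (RMod.regular A)
  let g : J → (A.X ⟶ A.X) := fun a => (f a).hom
  have g_mul : ∀ a, μ ≫ g a = g a ▷ A.X ≫ μ := fun a => (f a).act_hom
  have g_idem : ∀ a, g a ≫ g a = g a := fun a => congrArg RMod.Hom.hom (f_min a).idem
  let i : J → AlgIdempotent A := fun a => ofLeft (g a) (g_mul a) (g_idem a)
  have i_min : ∀ a, IsMinimal (i a) := fun a => isMinimal_ofLeft _ _ (f_min a)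
  have i_orth : ∀ a b, a ≠ b → (i a).L ≫ (i b).L = 0 := fun a b hab =>
    congrArg RMod.Hom.hom (f_orth a b hab)
  have i_sum : ∑ a, (i a).L = 𝟙 A.X :=
    (map_sum (RMod.homAddMonoidHom (RMod.regular A) (RMod.regular A)) f Finset.univ).symm.trans
      (congrArg RMod.Hom.hom f_sum)
  -- The classes of this relation will index the matrix blocks.
  let S : Setoid J :=
    ⟨fun a b => IsGeneratedBy (i a) (i b), fun a => isGeneratedBy_refl _,
      fun {a b} h => (i_min a).isGeneratedBy_symm (i_min b) h, fun h h' => h.trans h'⟩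
  obtain ⟨m, ⟨eQ⟩⟩ := Finite.exists_equiv_fin (Quotient S)
  let cls : J → Fin m := fun a => eQ ⟦a⟧
  have cls_iff : ∀ a b, cls a = cls b ↔ IsGeneratedBy (i a) (i b) := fun a b =>
    eQ.injective.eq_iff.trans Quotient.eq
  have orth : ∀ t, ∀ a b : {a // cls a = t}, a ≠ b → (i a).L ≫ (i b).L = 0 := fun t a b hab =>
    i_orth a b (Subtype.coe_injective.ne hab)
  let e : Fin m → AlgIdempotent A := fun t =>
    AlgIdempotent.sum (fun a : {a // cls a = t} => i a) (orth t)
  -- Idempotents of different classes have zero corners between them in both directions, since a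
  -- nonzero corner would put them in one class.
  have central : ∀ t, (e t).L = (e t).R := fun t =>
    sum_subtype_central i_sum (fun a => cls a = t) fun a b ha hb => by
      constructor
      · by_contra h0
        exact hb (((cls_iff a b).2 ((i_min a).isGeneratedBy h0)).symm.trans ha)
      · by_contra h0
        exact hb (((cls_iff b a).2 ((i_min b).isGeneratedBy h0)).trans ha)
  refine ⟨m, fun t => diag (e t), fun t => ?_, isDirectSum_of_central e central ?_ ?_⟩
  · have sep : IsSeparable (diag (e t)) :=
      (isDirectFactor_factorProj (e t) (central t)).isSeparable hA
    refine ⟨?_, sep⟩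
    -- A matrix algebra has at least one row, so the class must be nonempty and its size is written
    -- as `n + 1`.
    have : Nonempty {a // cls a = t} := by
      obtain ⟨q, rfl⟩ := eQ.surjective t
      obtain ⟨a, rfl⟩ := Quotient.exists_rep q
      exact ⟨⟨a, rfl⟩⟩
    obtain ⟨n, hn⟩ := Nat.exists_eq_succ_of_ne_zero (Fintype.card_ne_zero (α := {a // cls a = t}))
    let ε : Fin (n + 1) ≃ {a // cls a = t} := (Fintype.equivFinOfCardEq hn).symm
    have gen : ∀ a b : {a // cls a = t}, IsGeneratedBy (i a) (i b) := fun a b =>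
      (cls_iff a b).1 (a.2.trans b.2.symm)
    have hdiv : ∀ a, IsDivisionAlgebra (diag (i a)) := fun a => (i_min a).isDivisionAlgebra_diag
    -- The block and each of its diagonal corners generate one another, hence are Morita equivalent,
    -- and the block is separable as a direct factor of `A`.
    have hsep : ∀ a : {a // cls a = t}, IsSeparable (diag (i a)) := fun a =>
      (MoritaEquivalent.isSeparable_iff regC ⟨entry (e t) (i a), isInvertibleBimod_entry
        (isGeneratedBy_sum_left _ fun b => gen b a) (isGeneratedBy_sum_right (orth t) a)⟩).1 sep
    have heq : e t = AlgIdempotent.sum (fun a => i (ε a))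
        (fun a b hab => orth t _ _ (ε.injective.ne hab)) := by
      ext1
      · exact (Equiv.sum_comp ε fun a => (i a).L).symm
      · exact (Equiv.sum_comp ε fun a => (i a).R).symm
    change IsMatrixAlgebra k (diag (e t))
    rw [heq]
    exact ⟨matrixDecomposition _ _ (fun a b => gen _ _) (fun a => hdiv _)
      fun a => isSimpleAlgebra_of_isDivisionAlgebra hC (hsep _) (hdiv _)⟩
  · intro s t hst
    change (∑ a : {a // cls a = s}, (i a).L) ≫ (∑ a : {a // cls a = t}, (i a).L) = 0
    rw [Preadditive.sum_comp]
    refine Finset.sum_eq_zero fun a _ => ?_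
    rw [Preadditive.comp_sum]
    exact Finset.sum_eq_zero fun b _ => i_orth _ _ fun hab => hst (by rw [← a.2, ← b.2, hab])
  · change ∑ t, ∑ a : {a // cls a = t}, (i a).L = 𝟙 A.X
    rw [← i_sum]
    exact Fintype.sum_fiberwise cls fun a => (i a).L

end Matrix

end MultiFusion

end

noncomputable section

namespace MultiFusion

/-! ### Separability of matrix algebras -/

section Corner

variable {C : Type u} [Category.{v} C] [MonoidalCategory C]

/-- `f(1) = f(1) · f(f⁻¹(1)) = f(1 · f⁻¹(1)) = 1`. -/
lemma one_comp_of_mul_comp {X Y : Mon C} (f : X.X ≅ Y.X) (hf : μ ≫ f.hom = (f.hom ⊗ₘ f.hom) ≫ μ) :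
    η ≫ f.hom = η := by
  have h1 : η ≫ f.hom = (λ_ (𝟙_ C)).inv ≫ ((η ≫ f.hom) ⊗ₘ (η[Y.X] ≫ f.inv ≫ f.hom)) ≫ μ := by
    rw [f.inv_hom_id, Category.comp_id, MonoidalCategory.tensorHom_def_assoc, MonObj.mul_one,
      rightUnitor_naturality, ← unitors_equal, Iso.inv_hom_id_assoc]
  have h2 : η = (λ_ (𝟙_ C)).inv ≫ (η[X.X] ⊗ₘ (η[Y.X] ≫ f.inv)) ≫ μ ≫ f.hom := by
    rw [MonoidalCategory.tensorHom_def'_assoc, MonObj.one_mul_assoc,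
      leftUnitor_naturality_assoc, Iso.inv_hom_id_assoc, Category.assoc, f.inv_hom_id,
      Category.comp_id]
  rw [hf, tensorHom_comp_tensorHom_assoc, Category.assoc] at h2
  exact h1.trans h2.symm

/-- A multiplicative isomorphism is an isomorphism of algebras. -/
def monIsoOfMul {X Y : Mon C} (f : X.X ≅ Y.X) (hf : μ ≫ f.hom = (f.hom ⊗ₘ f.hom) ≫ μ) : X ≅ Y :=
  Mon.mkIso f (one_comp_of_mul_comp f hf) hf

lemma isSeparable_iff_of_iso {X Y : Mon C} (e : X ≅ Y) : IsSeparable X ↔ IsSeparable Y :=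
  ⟨(IsDirectFactor.of_iso e).isSeparable, (IsDirectFactor.of_iso e.symm).isSeparable⟩

variable {A : Mon C}

lemma AlgIdempotent.unit_L_R (e : AlgIdempotent A) : η ≫ e.L ≫ e.R = η ≫ e.L := by
  rw [← Category.assoc, e.unit, Category.assoc, e.R_R]

variable [IsIdempotentComplete C]

variable (A) in
/-- The corner of the unit is the whole algebra. -/
def diagOneIso : AlgIdempotent.diag (AlgIdempotent.one A) ≅ A :=
  monIsoOfMul
    ⟨AlgIdempotent.incl (.one A) (.one A), AlgIdempotent.proj (.one A) (.one A),
      AlgIdempotent.incl_proj _ _, (AlgIdempotent.proj_incl _ _).trans (Category.comp_id _)⟩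
    (AlgIdempotent.comp_incl _ _ _)

/-- If `e A e` is isomorphic to `D` with a multiplication that is a balanced map of
`D`-`D`-bimodules `D ⊗ D ⟶ D`, then `e A e` is isomorphic to `D` as an algebra. -/
lemma nonempty_diag_iso {e : AlgIdempotent A} {D : Mon C} (x : D.X ⟶ A.X) (p : A.X ⟶ D.X)
    (hxp : x ≫ p = 𝟙 D.X) (hpx : p ≫ x = e.L ≫ e.R) (c : D.X ⊗ D.X ⟶ D.X)
    (hc : (x ⊗ₘ x) ≫ μ = c ≫ x)
    (left : D.X ◁ c ≫ μ = (α_ _ _ _).inv ≫ μ ▷ D.X ≫ c)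
    (right : c ▷ D.X ≫ μ = (α_ _ _ _).hom ≫ D.X ◁ μ ≫ c)
    (balanced : μ ▷ D.X ≫ c = (α_ _ _ _).hom ≫ D.X ◁ μ ≫ c) :
    Nonempty (AlgIdempotent.diag e ≅ D) := by
  have hxLR : x ≫ e.L ≫ e.R = x := by rw [← hpx, reassoc_of% hxp]
  have hxR : x ≫ e.R = x := by
    rw [← hxLR]
    simp
  have : IsSplitMono x := ⟨⟨⟨p, hxp⟩⟩⟩
  -- The unit of `e A e`, carried to `D`, is a right unit for the multiplication `c`.
  let t : 𝟙_ C ⟶ D.X := η[A.X] ≫ p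
  have unit_c : D.X ◁ t ≫ c = (ρ_ _).hom := by
    rw [← cancel_mono x, Category.assoc, ← hc, MonoidalCategory.tensorHom_def'_assoc,
      ← MonoidalCategory.whiskerLeft_comp_assoc, Category.assoc, hpx, AlgIdempotent.unit_L_R,
      whisker_exchange_assoc, MonoidalCategory.whiskerLeft_comp_assoc, ← e.balanced,
      ← whisker_exchange_assoc, ← comp_whiskerRight_assoc, hxR, whisker_exchange_assoc,
      MonObj.mul_one, rightUnitor_naturality]
  -- By balancing and linearity, `c(a, b) = a z b` with `z = c(1, 1)` central, and `φ` is
  -- multiplication by `z`.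
  let φ : D.X ⟶ D.X := (ρ_ _).inv ≫ D.X ◁ η ≫ c
  have mul_φ : μ ≫ φ = c := by
    rw [rightUnitor_inv_naturality_assoc, ← whisker_exchange_assoc, balanced,
      associator_naturality_right_assoc, ← MonoidalCategory.whiskerLeft_comp_assoc, MonObj.mul_one]
    monoidal
  have φ_mul : φ ▷ D.X ≫ μ = c := by
    rw [comp_whiskerRight_assoc, comp_whiskerRight_assoc, right,
      associator_naturality_middle_assoc, ← MonoidalCategory.whiskerLeft_comp_assoc,
      MonObj.one_mul]
    monoidal
  have left_φ : D.X ◁ φ ≫ μ = c := by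
    rw [MonoidalCategory.whiskerLeft_comp_assoc, MonoidalCategory.whiskerLeft_comp_assoc, left,
      associator_inv_naturality_right_assoc, whisker_exchange_assoc]
    refine Eq.trans ?_ mul_φ
    rw [rightUnitor_inv_naturality_assoc]
    monoidal
  -- The unit `t` of `c` is inverse to `z`, so right multiplication by `t` inverts `φ`.
  let ψ : D.X ⟶ D.X := (ρ_ _).inv ≫ D.X ◁ t ≫ μ
  have φψ : φ ≫ ψ = 𝟙 _ := by
    rw [rightUnitor_inv_naturality_assoc, ← whisker_exchange_assoc, φ_mul, unit_c,
      Iso.inv_hom_id]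
  have ψφ : ψ ≫ φ = 𝟙 _ := by
    rw [Category.assoc, Category.assoc, mul_φ, unit_c, Iso.inv_hom_id]
  have hg : AlgIdempotent.incl e e ≫ p ≫ x = AlgIdempotent.incl e e := by
    rw [hpx, reassoc_of% AlgIdempotent.incl_L, AlgIdempotent.incl_R]
  let f : AlgIdempotent.corner e e ≅ D.X :=
    { hom := AlgIdempotent.incl e e ≫ p ≫ φ
      inv := ψ ≫ x ≫ AlgIdempotent.proj e e
      hom_inv_id := by
        simp only [Category.assoc]
        rw [reassoc_of% φψ, reassoc_of% hg, AlgIdempotent.incl_proj]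
      inv_hom_id := by
        have h1 : x ≫ AlgIdempotent.proj e e ≫ AlgIdempotent.incl e e = x := by
          rw [AlgIdempotent.proj_incl, hxLR]
        simp only [Category.assoc]
        rw [reassoc_of% h1, reassoc_of% hxp, ψφ] }
  refine ⟨monIsoOfMul f ?_⟩
  change AlgIdempotent.comp e e e ≫ AlgIdempotent.incl e e ≫ p ≫ φ =
    ((AlgIdempotent.incl e e ≫ p ≫ φ) ⊗ₘ (AlgIdempotent.incl e e ≫ p ≫ φ)) ≫ μ
  -- Untwisting: `(a z)(b z) = (a z b) z`, so `φ` carries `c` to the multiplication of `D`.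
  have h2 : (φ ⊗ₘ φ) ≫ μ = c ≫ φ := by
    rw [MonoidalCategory.tensorHom_def', Category.assoc, φ_mul, ← mul_φ, reassoc_of% left_φ, mul_φ]
  have h3 : c = (x ⊗ₘ x) ≫ μ ≫ p := by rw [reassoc_of% hc, hxp, Category.comp_id]
  rw [reassoc_of% AlgIdempotent.comp_incl, ← Category.assoc (AlgIdempotent.incl e e) p,
    ← tensorHom_comp_tensorHom (AlgIdempotent.incl e e ≫ p), Category.assoc, h2, h3,
    Category.assoc, Category.assoc, tensorHom_comp_tensorHom_assoc, Category.assoc, hg]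

end Corner

end MultiFusion

end

noncomputable section

namespace MultiFusion

/-! ### Linearity of the products induced by bimodule maps -/

section TensorBimod

variable {C : Type u} [Category.{v} C] [Abelian C] [MonoidalCategory C] [RigidCategory C]
  {X Y Z : Mon C} {P : Bimod X Y} {Q : Bimod Y Z} {R : Bimod X Z} (f : P.tensorBimod Q ⟶ R)

lemma whiskerLeft_tensorProj_comp_actLeft : X.X ◁ (tensorProj P Q ≫ f.hom) ≫ R.actLeft =
    (α_ _ _ _).inv ≫ P.actLeft ▷ Q.X ≫ tensorProj P Q ≫ f.hom := by
  rw [MonoidalCategory.whiskerLeft_comp_assoc, ← f.left_act_hom,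
    reassoc_of% whiskerLeft_tensorProj_actLeft]

lemma tensorProj_comp_whiskerRight_actRight : (tensorProj P Q ≫ f.hom) ▷ Z.X ≫ R.actRight =
    (α_ _ _ _).hom ≫ P.X ◁ Q.actRight ≫ tensorProj P Q ≫ f.hom := by
  rw [comp_whiskerRight_assoc, ← f.right_act_hom,
    reassoc_of% tensorProj_whiskerRight_actRight]

end TensorBimod

/-! ### The first diagonal entry of a matrix algebra as a corner -/

namespace MatrixDecomposition

attribute [local instance] Abelian.hasFiniteBiproducts

variable {k : Type w} [Field k] {C : Type u} [Category.{v} C] [Abelian C] [Linear k C]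
    [MonoidalCategory C] [MonoidalPreadditive C] [MonoidalLinear k C] [RigidCategory C] {A : Mon C}
    (d : MatrixDecomposition k A)

/-- The inclusion of an entry. -/
def incl (i j : Fin (d.n + 1)) : (d.entry i j).X ⟶ A.X :=
  biproduct.ι (fun p : Fin (d.n + 1) × Fin (d.n + 1) => (d.entry p.1 p.2).X) (i, j) ≫ d.decomp.inv

/-- The projection to an entry. -/
def proj (i j : Fin (d.n + 1)) : A.X ⟶ (d.entry i j).X :=
  d.decomp.hom ≫ biproduct.π (fun p : Fin (d.n + 1) × Fin (d.n + 1) => (d.entry p.1 p.2).X) (i, j)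

/-- The multiplication of two entries. -/
def comp (i j l : Fin (d.n + 1)) : (d.entry i j).X ⊗ (d.entry j l).X ⟶ (d.entry i l).X :=
  tensorProj (d.entry i j) (d.entry j l) ≫ (d.compIso i j l).hom.hom

lemma incl_proj (i j : Fin (d.n + 1)) : d.incl i j ≫ d.proj i j = 𝟙 _ := by
  rw [incl, proj, Category.assoc, Iso.inv_hom_id_assoc, biproduct.ι_π_self]

lemma incl_proj_ne {i j i' j' : Fin (d.n + 1)} (h : (i, j) ≠ (i', j')) :
    d.incl i j ≫ d.proj i' j' = 0 := by
  rw [incl, proj, Category.assoc, Iso.inv_hom_id_assoc, biproduct.ι_π_ne _ h]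

lemma sum_proj_incl : ∑ p : Fin (d.n + 1) × Fin (d.n + 1), d.proj p.1 p.2 ≫ d.incl p.1 p.2 =
    𝟙 A.X := by
  have : ∀ p : Fin (d.n + 1) × Fin (d.n + 1), d.proj p.1 p.2 ≫ d.incl p.1 p.2 =
      d.decomp.hom ≫ (biproduct.π (fun p : Fin (d.n + 1) × Fin (d.n + 1) =>
        (d.entry p.1 p.2).X) p ≫
          biproduct.ι (fun p : Fin (d.n + 1) × Fin (d.n + 1) => (d.entry p.1 p.2).X) p) ≫
        d.decomp.inv := fun p => by
    rw [incl, proj, Category.assoc, Category.assoc]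
  rw [Finset.sum_congr rfl fun p _ => this p, ← Preadditive.comp_sum, ← Preadditive.sum_comp,
    biproduct.total, Category.id_comp, Iso.hom_inv_id]

variable {d} in
lemma hom_ext {Y : C} {f g : A.X ⟶ Y} (h : ∀ i j, d.incl i j ≫ f = d.incl i j ≫ g) : f = g := by
  rw [← Category.id_comp f, ← Category.id_comp g, ← d.sum_proj_incl, Preadditive.sum_comp,
    Preadditive.sum_comp]
  exact Finset.sum_congr rfl fun p _ => by rw [Category.assoc, Category.assoc, h]

variable {d} in
lemma tensor_hom_ext {Y : C} {f g : A.X ⊗ A.X ⟶ Y}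
    (h : ∀ i j a b, (d.incl i j ⊗ₘ d.incl a b) ≫ f = (d.incl i j ⊗ₘ d.incl a b) ≫ g) : f = g := by
  have h1 : 𝟙 (A.X ⊗ A.X) = ∑ p : Fin (d.n + 1) × Fin (d.n + 1),
      ∑ q : Fin (d.n + 1) × Fin (d.n + 1), (d.proj p.1 p.2 ⊗ₘ d.proj q.1 q.2) ≫
        (d.incl p.1 p.2 ⊗ₘ d.incl q.1 q.2) := by
    simp only [tensorHom_comp_tensorHom]
    simp only [← tensor_sum, ← sum_tensor, sum_proj_incl, id_tensorHom_id]
  rw [← Category.id_comp f, ← Category.id_comp g, h1]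
  simp only [Preadditive.sum_comp, Category.assoc, h]

lemma tensorHom_mul (i j l : Fin (d.n + 1)) :
    (d.incl i j ⊗ₘ d.incl j l) ≫ μ = d.comp i j l ≫ d.incl i l :=
  (d.mul_comp i j l).trans (Category.assoc _ _ _).symm

lemma tensorHom_mul_ne (i : Fin (d.n + 1)) {j j' : Fin (d.n + 1)} (l : Fin (d.n + 1))
    (h : j ≠ j') : (d.incl i j ⊗ₘ d.incl j' l) ≫ μ = 0 :=
  d.mul_zero i j j' l h

/-- The projection to the first row. -/
def rowProj : A.X ⟶ A.X := ∑ l, d.proj 0 l ≫ d.incl 0 l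

/-- The projection to the first column. -/
def colProj : A.X ⟶ A.X := ∑ l, d.proj l 0 ≫ d.incl l 0

lemma incl_rowProj (l : Fin (d.n + 1)) : d.incl 0 l ≫ d.rowProj = d.incl 0 l := by
  rw [rowProj, Preadditive.comp_sum, Finset.sum_eq_single l, ← Category.assoc, incl_proj,
    Category.id_comp]
  · intro b _ hb
    rw [← Category.assoc, incl_proj_ne _ (fun h => hb (Prod.ext_iff.1 h).2.symm), zero_comp]
  · simp

lemma incl_rowProj_ne {i : Fin (d.n + 1)} (l : Fin (d.n + 1)) (h : i ≠ 0) :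
    d.incl i l ≫ d.rowProj = 0 := by
  rw [rowProj, Preadditive.comp_sum]
  refine Finset.sum_eq_zero fun b _ => ?_
  rw [← Category.assoc, incl_proj_ne _ (fun h' => h (Prod.ext_iff.1 h').1), zero_comp]

lemma incl_colProj (l : Fin (d.n + 1)) : d.incl l 0 ≫ d.colProj = d.incl l 0 := by
  rw [colProj, Preadditive.comp_sum, Finset.sum_eq_single l, ← Category.assoc, incl_proj,
    Category.id_comp]
  · intro b _ hb
    rw [← Category.assoc, incl_proj_ne _ (fun h => hb (Prod.ext_iff.1 h).1.symm), zero_comp]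
  · simp

lemma incl_colProj_ne (l : Fin (d.n + 1)) {i : Fin (d.n + 1)} (h : i ≠ 0) :
    d.incl l i ≫ d.colProj = 0 := by
  rw [colProj, Preadditive.comp_sum]
  refine Finset.sum_eq_zero fun b _ => ?_
  rw [← Category.assoc, incl_proj_ne _ (fun h' => h (Prod.ext_iff.1 h').2), zero_comp]

/-- On `A_{ij} ⊗ A_{ab}` both sides vanish unless `j = a = 0`, and there both are the
multiplication. -/
lemma colProj_mul : d.colProj ▷ A.X ≫ μ = A.X ◁ d.rowProj ≫ μ := by
  refine tensor_hom_ext (d := d) fun i j a b => ?_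
  rw [← tensorHom_id, ← id_tensorHom, tensorHom_comp_tensorHom_assoc,
    tensorHom_comp_tensorHom_assoc, Category.comp_id, Category.comp_id]
  by_cases hj : j = 0
  · subst hj
    rw [incl_colProj]
    by_cases ha : a = 0
    · subst ha
      rw [incl_rowProj]
    · rw [incl_rowProj_ne _ _ ha, tensorHom_mul_ne _ _ _ (Ne.symm ha)]
      simp
  · rw [incl_colProj_ne _ _ hj]
    by_cases ha : a = 0
    · subst ha
      rw [incl_rowProj, tensorHom_mul_ne _ _ _ hj]
      simp
    · rw [incl_rowProj_ne _ _ ha]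
      simp

/-- The idempotent of the first diagonal entry. -/
@[simps]
def idempotent : AlgIdempotent A where
  L := d.rowProj
  R := d.colProj
  mul_L := by
    refine tensor_hom_ext (d := d) fun i j a b => ?_
    rw [← tensorHom_id, tensorHom_comp_tensorHom_assoc, Category.comp_id]
    by_cases hj : j = a
    · subst hj
      rw [← Category.assoc, tensorHom_mul, Category.assoc]
      by_cases hi : i = 0
      · subst hi
        rw [incl_rowProj, incl_rowProj, tensorHom_mul]
      · rw [incl_rowProj_ne _ _ hi, incl_rowProj_ne _ _ hi]
        simp
    · rw [← Category.assoc, tensorHom_mul_ne _ _ _ hj, zero_comp]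
      by_cases hi : i = 0
      · subst hi
        rw [incl_rowProj, tensorHom_mul_ne _ _ _ hj]
      · rw [incl_rowProj_ne _ _ hi]
        simp
  mul_R := by
    refine tensor_hom_ext (d := d) fun i j a b => ?_
    rw [← id_tensorHom, tensorHom_comp_tensorHom_assoc, Category.comp_id]
    by_cases hj : j = a
    · subst hj
      rw [← Category.assoc, tensorHom_mul, Category.assoc]
      by_cases hb : b = 0
      · subst hb
        rw [incl_colProj, incl_colProj, tensorHom_mul]
      · rw [incl_colProj_ne _ _ hb, incl_colProj_ne _ _ hb]
        simp
    · rw [← Category.assoc, tensorHom_mul_ne _ _ _ hj, zero_comp]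
      by_cases hb : b = 0
      · subst hb
        rw [incl_colProj, tensorHom_mul_ne _ _ _ hj]
      · rw [incl_colProj_ne _ _ hb]
        simp
  balanced := d.colProj_mul
  L_L := by
    refine hom_ext (d := d) fun i j => ?_
    by_cases hi : i = 0
    · subst hi
      rw [← Category.assoc, incl_rowProj, incl_rowProj]
    · rw [← Category.assoc, incl_rowProj_ne _ _ hi, zero_comp]
  R_R := by
    refine hom_ext (d := d) fun i j => ?_
    by_cases hj : j = 0
    · subst hj
      rw [← Category.assoc, incl_colProj, incl_colProj]
    · rw [← Category.assoc, incl_colProj_ne _ _ hj, zero_comp]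
  unit := by
    -- The decomposition says nothing about the unit of `A`. Both values at the unit are obtained
    -- from `1 ⊗ 1`, one as `1 · e(1)` and the other as `(1)e · 1`, and agree by `colProj_mul`.
    have h1 : η ≫ d.rowProj = (λ_ (𝟙_ C)).inv ≫ (η ⊗ₘ η) ≫ A.X ◁ d.rowProj ≫ μ := by
      rw [← id_tensorHom, tensorHom_comp_tensorHom_assoc, Category.comp_id,
        MonoidalCategory.tensorHom_def'_assoc, MonObj.one_mul, leftUnitor_naturality,
        Iso.inv_hom_id_assoc]
    have h2 : η ≫ d.colProj = (λ_ (𝟙_ C)).inv ≫ (η ⊗ₘ η) ≫ d.colProj ▷ A.X ≫ μ := by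
      rw [← tensorHom_id, tensorHom_comp_tensorHom_assoc, Category.comp_id,
        MonoidalCategory.tensorHom_def_assoc, MonObj.mul_one, rightUnitor_naturality,
        ← unitors_equal, Iso.inv_hom_id_assoc]
    rw [h1, h2, colProj_mul]

lemma proj_incl_zero : d.proj 0 0 ≫ d.incl 0 0 = d.rowProj ≫ d.colProj := by
  refine hom_ext (d := d) fun i j => ?_
  by_cases hi : i = 0
  · subst hi
    rw [reassoc_of% d.incl_rowProj]
    by_cases hj : j = 0
    · subst hj
      rw [reassoc_of% d.incl_proj, incl_colProj]
    · rw [incl_colProj_ne _ _ hj, ← Category.assoc,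
        incl_proj_ne _ (fun h => hj (Prod.ext_iff.1 h).2), zero_comp]
  · rw [← Category.assoc, ← Category.assoc, incl_rowProj_ne _ _ hi, zero_comp,
      incl_proj_ne _ (fun h => hi (Prod.ext_iff.1 h).1), zero_comp]

instance (i j l : Fin (d.n + 1)) : Epi (d.comp i j l) := by
  have : IsIso (d.compIso i j l).hom.hom := ⟨(d.compIso i j l).inv.hom,
    congrArg Bimod.Hom.hom (d.compIso i j l).hom_inv_id,
    congrArg Bimod.Hom.hom (d.compIso i j l).inv_hom_id⟩
  exact epi_comp _ _

/-- Every `A_{ij}` is reached by `x ⊗ y ↦ x e y`, already from `A_{i1} ⊗ A_{1j}`, because the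
relative products are isomorphisms. -/
instance : Epi (d.colProj ▷ A.X ≫ μ) := by
  refine ⟨fun f g h => hom_ext (d := d) fun i j => ?_⟩
  rw [← cancel_epi (d.comp i 0 j), ← Category.assoc, ← Category.assoc, ← tensorHom_mul]
  have h1 : (d.incl i 0 ⊗ₘ d.incl 0 j) ≫ μ = (d.incl i 0 ⊗ₘ d.incl 0 j) ≫ d.colProj ▷ A.X ≫ μ := by
    rw [← tensorHom_id, tensorHom_comp_tensorHom_assoc, Category.comp_id, incl_colProj]
  rw [h1, Category.assoc, h, ← Category.assoc]

/-- The epimorphism `x ⊗ y ↦ x e y` splits in `C`. Applying a splitting to the unit writes `1` as `∑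
x e y`, so `A` and `e A e` are linked by the invertible bimodule `A e`. -/
lemma moritaEquivalent (hC : IsVonNeumannRegular C) :
    MoritaEquivalent (AlgIdempotent.diag (AlgIdempotent.one A))
      (AlgIdempotent.diag d.idempotent) := by
  obtain ⟨⟨s, hs⟩⟩ := hC.isSplitEpi (d.colProj ▷ A.X ≫ μ)
  refine ⟨AlgIdempotent.entry _ _, AlgIdempotent.isInvertibleBimod_entry
    ⟨η ≫ s, ?_⟩ ((AlgIdempotent.isGeneratedBy_refl _).mono_right (Category.comp_id _))⟩
  rw [Category.assoc]
  exact congrArg (η ≫ ·) hs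

/-- The isomorphisms `entry_self 0` and `compIso 0 0 0` are only bimodule maps with no compatibility
between them. Through them `e A e` becomes `D` with some balanced bimodule multiplication in place
of its own, which is the situation of `nonempty_diag_iso`. -/
lemma nonempty_diag_idempotent_iso :
    Nonempty (AlgIdempotent.diag d.idempotent ≅ d.diag 0) := by
  let D := d.diag 0
  let E := d.entry 0 0
  let act : D.X ⊗ E.X ⟶ E.X := E.actLeft
  let act' : E.X ⊗ D.X ⟶ E.X := E.actRight
  let θ : E.X ⟶ D.X := (d.entry_self 0).hom.hom
  let θ' : D.X ⟶ E.X := (d.entry_self 0).inv.hom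
  have θθ' : θ ≫ θ' = 𝟙 E.X := congrArg Bimod.Hom.hom (d.entry_self 0).hom_inv_id
  have θ'θ : θ' ≫ θ = 𝟙 D.X := congrArg Bimod.Hom.hom (d.entry_self 0).inv_hom_id
  have θ_left : act ≫ θ = D.X ◁ θ ≫ μ := (d.entry_self 0).hom.left_act_hom
  have θ_right : act' ≫ θ = θ ▷ D.X ≫ μ := (d.entry_self 0).hom.right_act_hom
  have θ'_left : μ ≫ θ' = D.X ◁ θ' ≫ act := (d.entry_self 0).inv.left_act_hom
  have θ'_right : μ ≫ θ' = θ' ▷ D.X ≫ act' := (d.entry_self 0).inv.right_act_hom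
  let m : E.X ⊗ E.X ⟶ E.X := d.comp 0 0 0
  have m_left : D.X ◁ m ≫ act = (α_ _ _ _).inv ≫ act ▷ E.X ≫ m :=
    whiskerLeft_tensorProj_comp_actLeft _
  have m_right : m ▷ D.X ≫ act' = (α_ _ _ _).hom ≫ E.X ◁ act' ≫ m :=
    tensorProj_comp_whiskerRight_actRight _
  have m_balanced : act' ▷ E.X ≫ m = (α_ _ _ _).hom ≫ E.X ◁ act ≫ m := by
    have h := congrArg (· ≫ (d.compIso 0 0 0).hom.hom) (tensorProj_condition E E)
    simp only [Category.assoc] at h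
    exact h
  refine nonempty_diag_iso (θ' ≫ d.incl 0 0) (d.proj 0 0 ≫ θ) ?_ ?_ ((θ' ⊗ₘ θ') ≫ m ≫ θ) ?_ ?_ ?_ ?_
  · rw [Category.assoc, reassoc_of% d.incl_proj, θ'θ]
  · rw [Category.assoc, reassoc_of% θθ', proj_incl_zero]
    rfl
  · rw [← tensorHom_comp_tensorHom, Category.assoc, tensorHom_mul]
    simp only [Category.assoc]
    rw [reassoc_of% θθ']
  · rw [MonoidalCategory.whiskerLeft_comp_assoc, MonoidalCategory.whiskerLeft_comp_assoc, ← θ_left,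
      reassoc_of% m_left, ← id_tensorHom, associator_inv_naturality_assoc, ← tensorHom_id,
      tensorHom_comp_tensorHom_assoc, id_tensorHom, ← θ'_left, Category.comp_id, ← tensorHom_id,
      tensorHom_comp_tensorHom_assoc, Category.id_comp]
  · rw [comp_whiskerRight_assoc, comp_whiskerRight_assoc, ← θ_right,
      reassoc_of% m_right, ← tensorHom_id, associator_naturality_assoc, ← id_tensorHom,
      tensorHom_comp_tensorHom_assoc, tensorHom_id, ← θ'_right, Category.comp_id, ← id_tensorHom,
      tensorHom_comp_tensorHom_assoc, Category.id_comp]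
  · have h1 : μ ▷ D.X ≫ (θ' ⊗ₘ θ') = ((θ' ⊗ₘ 𝟙 D.X) ⊗ₘ θ') ≫ act' ▷ E.X := by
      rw [← tensorHom_id, ← tensorHom_id, tensorHom_comp_tensorHom, tensorHom_comp_tensorHom,
        Category.id_comp, Category.comp_id, tensorHom_id, θ'_right]
    have h2 : D.X ◁ μ ≫ (θ' ⊗ₘ θ') = (θ' ⊗ₘ (𝟙 D.X ⊗ₘ θ')) ≫ E.X ◁ act := by
      rw [← id_tensorHom, ← id_tensorHom, tensorHom_comp_tensorHom, tensorHom_comp_tensorHom,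
        Category.id_comp, Category.comp_id, id_tensorHom, θ'_left]
    rw [reassoc_of% h1, reassoc_of% h2, reassoc_of% m_balanced, associator_naturality_assoc]

/-- A matrix algebra is separable if and only if its first diagonal entry is. -/
theorem isSeparable_iff (hC : IsVonNeumannRegular C) : IsSeparable A ↔ IsSeparable (d.diag 0) := by
  obtain ⟨e⟩ := d.nonempty_diag_idempotent_iso
  rw [← isSeparable_iff_of_iso (diagOneIso A), (d.moritaEquivalent hC).isSeparable_iff hC,
    isSeparable_iff_of_iso e]

end MatrixDecomposition

end MultiFusion

end

theorem mainTheorem2 {k : Type w} [Field k] {C : Type u} [Category.{v} C] [Abelian C] [Linear k C]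
    [MonoidalCategory C] [MonoidalPreadditive C] [MonoidalLinear k C] [RigidCategory C]
    (hC : MultiFusion.IsSemisimpleCategory k C) :
    (∀ A : Mon C, MultiFusion.IsSeparable A ↔
      ∃ (m : ℕ) (B : Fin m → Mon C),
        (∀ i, MultiFusion.IsMatrixAlgebra k (B i) ∧ MultiFusion.IsSeparable (B i)) ∧
          MultiFusion.IsDirectSum A B) ∧
    (∀ (A : Mon C) (d : MultiFusion.MatrixDecomposition k A),
      MultiFusion.IsSeparable A ↔ MultiFusion.IsSeparable (d.diag 0)) ∧
    (∀ A B : Mon C, MultiFusion.MoritaEquivalent A B →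
      (MultiFusion.IsSeparable A ↔ MultiFusion.IsSeparable B)) := by
  have reg := hC.isVonNeumannRegular
  refine ⟨fun A => ⟨fun h => h.exists_isDirectSum hC, ?_⟩, fun A d => d.isSeparable_iff reg,
    fun A B h => h.isSeparable_iff reg⟩
  rintro ⟨m, B, hB, h⟩
  exact h.isSeparable fun i => (hB i).2
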